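/- **Setting.** Let $\mathcal K\subseteq\mathbb R^d$ be a convex set with more than one point, let $\mathcal L_0$ be the linear space parallel to its affine hull $\operatorname{aff}(\mathcal K)$ and $k=\dim\mathcal L_0\ge 1$. Let $c$ be a point of the relative interior of $\mathcal K$, let $r>0$ be such that $\{x\in\operatorname{aff}(\mathcal K):\|x-c\|\le r\}\subseteq\mathcal K$, and let $0<\delta\le\alpha<r$. Put $\hat{\mathcal K}=(1-\frac{\alpha}{r})\mathcal K+\frac{\alpha}{r}c$. Let $\mathbf F$ be a set of continuous functions $\mathcal K\to\mathbb R$, let $\mathcal U\subseteq\mathcal K^T$ be nonempty and compact, and let $\hat{\mathcal U}=(1-\frac{\alpha}{r})\,\mathcal U+\frac{\alpha}{r}(c,\dots,c)\subseteq\hat{\mathcal K}^T$. For $f\in\mathbf F$ let $\hat f:\hat{\mathcal K}\to\mathbb R$, $\hat f(x)=\mathbb E[f(x+\delta v)]$ with $v$ uniform on the unit ball of $\mathcal L_0$, and let $\hat{\mathbf F}=\{\hat f: f\in\mathbf F\}$. **Game.** In each round $t=1,\dots,T$ an agent plays a point $x_t$ of its domain and observes a single random answer of a query oracle at $x_t$.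 Its action is a function of its own randomness $\omega$ (sampled before round $1$) and of the earlier actions and observations. An oblivious realized adversary with losses in a class $\mathbf G$ is a fixed sequence $f_1,\dots,f_T\in\mathbf G$ with fixed query oracles $\mathcal Q_1,\dots,\mathcal Q_T$ for these functions, the answers in different rounds using independent randomness. $\mathrm{Adv}^{\mathrm o}_0(\mathbf G,B)$ is the set of those for which every $\mathcal Q_t$ is a stochastic value oracle, i.e. $\mathcal Q_t(x)\in\mathbb R$ and $\mathbb E[\mathcal Q_t(x)]=f_t(x)$ for all $x$, with answers bounded by $B$ in absolute value. $\mathrm{Adv}^{\mathrm o}_1(\mathbf G,B)$ is the set of those for which every $\mathcal Q_t$ is a stochastic gradient oracle or a stochastic subgradient oracle, i.e. $\mathcal Q_t(x)\in\mathbb R^d$ and $\mathbb E[\mathcal Q_t(x)]$ is the gradient of $f_t$ at $x$ for all $x$ (relative to the domain, and parallel to its affine hull), or is a subgradient of $f_t$ at $x$ for all $x$, with answers of Euclidean norm at most $B$. For $1\le a\le b\le T$, an agent $\mathcal A$, a set $\mathrm{Adv}$ of realized adversaries and a set $\mathcal V$ of comparator sequences, the regret is $$\mathcal R^{\mathcal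 A}_{\mathrm{Adv}}(\mathcal V)=\sup_{\mathrm{Adv}}\ \mathbb E\Big[\sum_{t=a}^b f_t(x_t)-\min_{u\in\mathcal V}\sum_{t=a}^b f_t(u_t)\Big]\in[-\infty,\infty],$$ the expectation being over the randomness of the agent and of the oracles. **Meta-algorithm.** Let $\mathcal A$ be a semi-bandit agent with domain $\hat{\mathcal K}$, i.e. its observations are vectors in $\mathbb R^d$. The bandit agent $\mathtt{STB}(\mathcal A)$ with domain $\mathcal K$ does the following in round $t$: it samples $v_t$ uniformly from the unit sphere of $\mathcal L_0$, independently of everything else; it plays $x_t+\delta v_t$, where $x_t$ is the action chosen by $\mathcal A$; it receives the output $o_t\in\mathbb R$ of the value oracle at the point played; and it passes $\frac{k}{\delta}o_tv_t$ to $\mathcal A$ as the oracle output. **Theorem.** Let $\mathcal A'=\mathtt{STB}(\mathcal A)$, let $B_0\in\mathbb R$ and $1\le a\le b\le T$. 1. If every $f\in\mathbf F$ is convex with values in $[-M_0,M_0]$, then $$\mathcal R^{\mathcal A'}_{\mathrm{Adv}^{\mathrm o}_0(\mathbf F,B_0)}(\mathcal U)\le\mathcal R^{\mathcal A}_{\mathrm{Adv}^{\mathrm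 o}_1(\hat{\mathbf F},\frac k\delta B_0)}(\hat{\mathcal U})+\Big(\frac{6\delta}{\alpha}+\frac{2\alpha}{r}\Big)M_0T.$$ 2. If every $f\in\mathbf F$ is convex with values in $[0,M_0]$, then $$\mathcal R^{\mathcal A'}_{\mathrm{Adv}^{\mathrm o}_0(\mathbf F,B_0)}(\mathcal U)\le\mathcal R^{\mathcal A}_{\mathrm{Adv}^{\mathrm o}_1(\hat{\mathbf F},\frac k\delta B_0)}(\hat{\mathcal U})+\Big(\frac{6\delta}{\alpha}+\frac{\alpha}{r}\Big)M_0T.$$ 3. If every $f\in\mathbf F$ is $M_1$-Lipschitz (not necessarily convex) and $\mathcal K$ is contained in a closed ball of radius $D$ (for instance, $D$ is the diameter of $\mathcal K$), then $$\mathcal R^{\mathcal A'}_{\mathrm{Adv}^{\mathrm o}_0(\mathbf F,B_0)}(\mathcal U)\le\mathcal R^{\mathcal A}_{\mathrm{Adv}^{\mathrm o}_1(\hat{\mathbf F},\frac k\delta B_0)}(\hat{\mathcal U})+\Big(3+\frac{2D\alpha}{r\delta}\Big)\delta M_1T.$$ -/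

import Mathlib

open MeasureTheory ProbabilityTheory Topology Asymptotics
open scoped InnerProductSpace

noncomputable section

namespace OnlineOpt

/-! ### Agents with trivial query function, oblivious adversaries, and the game -/

/-- An agent for `T` rounds with action set `K` and observation space `O`, whose query function is
trivial: in every round it makes one query, at the point it plays.  It samples `ω` from its own
probability space before the first round; its action in a round is a function of `ω` and of the
previous pairs (action, observation).  It takes semi-bandit feedback when it faces first-order
oracles (`O` is the Euclidean space) and bandit feedback when it faces zeroth-order oracles
(`O = ℝ`). Rounds are indexed from `0`. -/
structure Agent (T : ℕ) (K O : Type) [MeasurableSpace K] [MeasurableSpace O] where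
  Ω : Type*
  [mΩ : MeasurableSpace Ω]
  P : Measure Ω
  [isProb : IsProbabilityMeasure P]
  act : (t : Fin T) → Ω → (Fin t → K × O) → K
  measurable_act : ∀ t : Fin T, Measurable fun p : Ω × (Fin t → K × O) => act t p.1 p.2

attribute [instance] Agent.mΩ Agent.isProb

/-- An oblivious realized adversary: a fixed sequence of loss functions, and a fixed sequence of
query oracles.  A query oracle assigns to each point `x` the law of its random answer; the answers
in different rounds use independent randomness. -/
structure ObliviousAdversary (T : ℕ) (K O : Type) [MeasurableSpace K] [MeasurableSpace O] where
  loss : Fin T → K → ℝ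
  oracle : Fin T → Kernel K O
  [markov : ∀ t, IsMarkovKernel (oracle t)]

attribute [instance] ObliviousAdversary.markov

section Game

variable {T : ℕ} {K O : Type} [MeasurableSpace K] [MeasurableSpace O]

/-- The law of the observation in round `t`, given `ω` and the history. -/
def observation (A : Agent T K O) (B : ObliviousAdversary T K O) (t : Fin T) :
    Kernel (A.Ω × (Fin t → K × O)) O :=
  (B.oracle t).comap (fun p => A.act t p.1 p.2) (A.measurable_act t)

/-- The joint law of `ω` and of the first `t` pairs (action, observation). -/
def gameLaw (A : Agent T K O) (B : ObliviousAdversary T K O) :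
    (t : ℕ) → t ≤ T → Measure (A.Ω × (Fin t → K × O))
  | 0, _ => A.P.map fun ω => (ω, Fin.elim0)
  | t + 1, ht =>
    (gameLaw A B t (Nat.le_of_succ_le ht) ⊗ₘ observation A B ⟨t, ht⟩).map fun p =>
      (p.1.1, Fin.snoc (α := fun _ => K × O) p.1.2 (A.act ⟨t, ht⟩ p.1.1 p.1.2, p.2))

/-- The regret of `A` against the realized adversary `B` on the rounds `a, …, b`, with respect to
the set `U` of comparator sequences. -/
def realizedRegret (A : Agent T K O) (B : ObliviousAdversary T K O) (U : Set (Fin T → K))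
    (a b : Fin T) : ℝ :=
  ∫ p, (∑ t ∈ Finset.Icc a b, B.loss t (p.2 t).1
      - sInf ((fun u : Fin T → K => ∑ t ∈ Finset.Icc a b, B.loss t (u t)) '' U))
    ∂(gameLaw A B T le_rfl)

/-- The regret of `A` against an adversary, i.e. a set of realized adversaries. The supremum is
taken in the extended reals, so that it is `⊥` for the empty set. -/
def regret (A : Agent T K O) (Adv : Set (ObliviousAdversary T K O)) (U : Set (Fin T → K))
    (a b : Fin T) : EReal :=
  ⨆ B ∈ Adv, ((realizedRegret A B U a b : ℝ) : EReal)

end Game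

/-! ### Function classes and oracles -/

section Oracles

variable {d : ℕ} {K : Set (EuclideanSpace ℝ (Fin d))}

/-- Convexity of a function whose domain is the (convex) set `K`. -/
def IsConvexFun (f : K → ℝ) : Prop :=
  ∀ x y z : K, ∀ s : ℝ, 0 ≤ s → s ≤ 1 →
    (z : EuclideanSpace ℝ (Fin d)) = s • (x : EuclideanSpace ℝ (Fin d)) + (1 - s) • (y : _) →
    f z ≤ s * f x + (1 - s) * f y

/-- `g` is the gradient at `x` of a function whose domain is `K`. It is taken parallel to the affine
hull of `K`, which makes it unique when `K` is convex; there is no such restriction when `K` spans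
the whole space. -/
def IsGradientAt (f : K → ℝ) (x : K) (g : EuclideanSpace ℝ (Fin d)) : Prop :=
  g ∈ vectorSpan ℝ K ∧
  (fun y : K => f y - f x - ⟪g, (y : EuclideanSpace ℝ (Fin d)) - x⟫_ℝ)
    =o[𝓝 x] fun y : K => (y : EuclideanSpace ℝ (Fin d)) - x

/-- `g` is a subgradient at `x` of a function whose domain is `K`. -/
def IsSubgradientAt (f : K → ℝ) (x : K) (g : EuclideanSpace ℝ (Fin d)) : Prop :=
  ∀ y : K, ⟪g, (y : EuclideanSpace ℝ (Fin d)) - x⟫_ℝ ≤ f y - f x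

/-- Stochastic zeroth-order oracle (value oracle). -/
def IsValueOracle (f : K → ℝ) (Q : Kernel K ℝ) : Prop :=
  ∀ x, Integrable id (Q x) ∧ ∫ o, o ∂(Q x) = f x

/-- Stochastic first-order oracle: a stochastic gradient oracle or a stochastic subgradient
oracle. -/
def IsFirstOrderOracle (f : K → ℝ) (Q : Kernel K (EuclideanSpace ℝ (Fin d))) : Prop :=
  (∀ x, Integrable id (Q x)) ∧
  ((∀ x, IsGradientAt f x (∫ o, o ∂(Q x))) ∨ (∀ x, IsSubgradientAt f x (∫ o, o ∂(Q x))))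

/-- The output of the oracle always lies in the ball of radius `B` about the origin. -/
def IsBoundedOracle {O : Type} [NormedAddCommGroup O] [MeasurableSpace O] (Q : Kernel K O)
    (B : ℝ) : Prop :=
  ∀ x, ∀ᵐ o ∂(Q x), ‖o‖ ≤ B

/-- All oblivious realized adversaries with losses in `F` and stochastic zeroth-order oracles
bounded by `B`. -/
def advZero (T : ℕ) (F : Set (K → ℝ)) (B : ℝ) : Set (ObliviousAdversary T K ℝ) :=
  {𝓑 | ∀ t, 𝓑.loss t ∈ F ∧ IsValueOracle (𝓑.loss t) (𝓑.oracle t) ∧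
    IsBoundedOracle (𝓑.oracle t) B}

/-- All oblivious realized adversaries with losses in `F` and stochastic first-order oracles
bounded by `B`. -/
def advOne (T : ℕ) (F : Set (K → ℝ)) (B : ℝ) :
    Set (ObliviousAdversary T K (EuclideanSpace ℝ (Fin d))) :=
  {𝓑 | ∀ t, 𝓑.loss t ∈ F ∧ IsFirstOrderOracle (𝓑.loss t) (𝓑.oracle t) ∧
    IsBoundedOracle (𝓑.oracle t) B}

end Oracles

/-! ### Shrinking and smoothing -/

section Uniform

variable (L : Type) [NormedAddCommGroup L] [InnerProductSpace ℝ L] [FiniteDimensional ℝ L]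
  [MeasurableSpace L] [BorelSpace L]

/-- The uniform distribution on the unit sphere. -/
def unifSphere : Measure (Metric.sphere (0 : L) 1) :=
  ((volume : Measure L).toSphere Set.univ)⁻¹ • (volume : Measure L).toSphere

/-- The uniform distribution on the closed unit ball. -/
def unifBall : Measure (Metric.closedBall (0 : L) 1) :=
  (cond (volume : Measure L) (Metric.closedBall 0 1)).comap Subtype.val

theorem isProbabilityMeasure_unifSphere [Nontrivial L] : IsProbabilityMeasure (unifSphere L) := by
  have h0 : (volume : Measure L).toSphere Set.univ ≠ 0 := by
    rw [Ne, Measure.measure_univ_eq_zero]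
    exact Measure.toSphere_ne_zero _
  constructor
  rw [unifSphere, Measure.smul_apply, smul_eq_mul]
  exact ENNReal.inv_mul_cancel h0 (measure_ne_top _ _)

end Uniform

variable {d : ℕ}

/-- The shrunk domain `(1 - α / r) K + (α / r) c`. -/
def shrunk (K : Set (EuclideanSpace ℝ (Fin d))) (c : EuclideanSpace ℝ (Fin d)) (r α : ℝ) :
    Set (EuclideanSpace ℝ (Fin d)) :=
  (fun y => (1 - α / r) • y + (α / r) • c) '' K

/-- The map `y ↦ (1 - α / r) y + (α / r) c` from `K` to the shrunk domain. -/
def shrinkMap (K : Set (EuclideanSpace ℝ (Fin d))) (c : EuclideanSpace ℝ (Fin d)) (r α : ℝ)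
    (y : K) : shrunk K c r α :=
  ⟨(1 - α / r) • (y : EuclideanSpace ℝ (Fin d)) + (α / r) • c, Set.mem_image_of_mem _ y.2⟩

/-- The set `(1 - α / r) U + (α / r) c` of comparator sequences in the shrunk domain. -/
def shrunkComparators {T : ℕ} {K : Set (EuclideanSpace ℝ (Fin d))} (c : EuclideanSpace ℝ (Fin d))
    (r α : ℝ) (U : Set (Fin T → K)) : Set (Fin T → shrunk K c r α) :=
  (fun u t => shrinkMap K c r α (u t)) '' U

/-- The domain `K` is convex with more than one point, `c` is in its relative interior, the ball of
radius `r` about `c` in the affine hull of `K` lies in `K`, and `0 < δ ≤ α < r`. -/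
structure Admissible (K : Set (EuclideanSpace ℝ (Fin d))) (c : EuclideanSpace ℝ (Fin d))
    (r α δ : ℝ) : Prop where
  convex : Convex ℝ K
  nontrivial : K.Nontrivial
  mem_relint : c ∈ intrinsicInterior ℝ K
  r_pos : 0 < r
  ball_subset : Metric.closedBall c r ∩ (affineSpan ℝ K : Set (EuclideanSpace ℝ (Fin d))) ⊆ K
  δ_pos : 0 < δ
  δ_le : δ ≤ α
  α_lt : α < r

section Smoothing

variable {K : Set (EuclideanSpace ℝ (Fin d))} {c : EuclideanSpace ℝ (Fin d)} {r α δ : ℝ}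

theorem Admissible.nontrivial_vectorSpan (h : Admissible K c r α δ) :
    Nontrivial (vectorSpan ℝ K) := by
  obtain ⟨x, hx, y, hy, hxy⟩ := h.nontrivial
  refine ⟨⟨⟨x -ᵥ y, vsub_mem_vectorSpan ℝ hx hy⟩, 0, fun h0 => hxy ?_⟩⟩
  have := congrArg Subtype.val h0
  simpa [sub_eq_zero] using this

theorem Admissible.add_mem (h : Admissible K c r α δ) {x : EuclideanSpace ℝ (Fin d)}
    (hx : x ∈ shrunk K c r α) (v : vectorSpan ℝ K) (hv : ‖v‖ ≤ 1) :
    x + δ • (v : EuclideanSpace ℝ (Fin d)) ∈ K := by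
  obtain ⟨y, hy, rfl⟩ := hx
  have hr := h.r_pos
  have hδ := h.δ_pos
  have hα : 0 < α := hδ.trans_le h.δ_le
  have hc : c ∈ affineSpan ℝ K := subset_affineSpan ℝ K (intrinsicInterior_subset h.mem_relint)
  have hz : c + (r * δ / α) • (v : EuclideanSpace ℝ (Fin d)) ∈ K := by
    apply h.ball_subset
    constructor
    · have hle : r * δ / α * ‖v‖ ≤ r * 1 := by
        rw [mul_div_assoc, mul_assoc]
        have h1 : δ / α ≤ 1 := (div_le_one hα).2 h.δ_le
        have h2 : δ / α * ‖v‖ ≤ 1 := mul_le_one₀ h1 (norm_nonneg _) hv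
        gcongr
      rw [mem_closedBall_iff_norm, add_sub_cancel_left, norm_smul, Real.norm_of_nonneg
        (by positivity)]
      simpa using hle
    · have hmem : (r * δ / α) • (v : EuclideanSpace ℝ (Fin d)) ∈ (affineSpan ℝ K).direction := by
        rw [direction_affineSpan]
        exact Submodule.smul_mem _ _ v.2
      have := AffineSubspace.vadd_mem_of_mem_direction hmem hc
      rwa [vadd_eq_add, add_comm] at this
  have hcomb := h.convex hy hz (a := 1 - α / r) (b := α / r)
    (by rw [sub_nonneg, div_le_one hr]; exact h.α_lt.le) (by positivity) (by ring)
  have hcoef : α / r * (r * δ / α) = δ := by field_simp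
  simpa only [smul_add, smul_smul, hcoef, add_assoc] using hcomb

/-- The smoothed function on the shrunk domain: `x ↦ E f(x + δ v)`, with `v` uniform on the unit
ball of the linear space parallel to the affine hull of `K`. -/
def smoothed (h : Admissible K c r α δ) (f : K → ℝ) : shrunk K c r α → ℝ := fun x =>
  ∫ v, f ⟨(x : EuclideanSpace ℝ (Fin d)) + δ • ((v : vectorSpan ℝ K) : EuclideanSpace ℝ (Fin d)),
      h.add_mem x.2 v (mem_closedBall_zero_iff.1 v.2)⟩ ∂(unifBall (vectorSpan ℝ K))

/-- The class of the smoothed functions of the members of `F`. -/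
def smoothedClass (h : Admissible K c r α δ) (F : Set (K → ℝ)) : Set (shrunk K c r α → ℝ) :=
  smoothed h '' F

/-! ### The meta-algorithm `STB` -/

/-- The unit sphere of the linear space parallel to the affine hull of `K`. -/
abbrev Dir (K : Set (EuclideanSpace ℝ (Fin d))) : Type := Metric.sphere (0 : vectorSpan ℝ K) 1

variable {T : ℕ}

/-- What the base algorithm `A` has played and received in the first `t` rounds of `STB(A)`, given
its own randomness `ω`, the sampled directions `v` and the outputs `o` of the value oracle: in each
round it plays its action `x` and is passed `(k / δ) o v`. -/
def baseHistory (δ : ℝ) (A : Agent T (shrunk K c r α) (EuclideanSpace ℝ (Fin d))) (ω : A.Ω)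
    (v : Fin T → Dir K) :
    (t : ℕ) → t ≤ T → (Fin t → ℝ) → (Fin t → shrunk K c r α × EuclideanSpace ℝ (Fin d))
  | 0, _, _ => Fin.elim0
  | t + 1, ht, o =>
    let past := baseHistory δ A ω v t (Nat.le_of_succ_le ht) (fun s => o s.castSucc)
    Fin.snoc (α := fun _ => shrunk K c r α × EuclideanSpace ℝ (Fin d)) past
      (A.act ⟨t, ht⟩ ω past,
        ((Module.finrank ℝ (vectorSpan ℝ K) : ℝ) / δ * o (Fin.last t)) •
          ((v ⟨t, ht⟩ : vectorSpan ℝ K) : EuclideanSpace ℝ (Fin d)))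

theorem measurable_baseHistory (δ : ℝ)
    (A : Agent T (shrunk K c r α) (EuclideanSpace ℝ (Fin d))) (t : ℕ) (ht : t ≤ T) :
    Measurable fun p : (A.Ω × (Fin T → Dir K)) × (Fin t → ℝ) =>
      baseHistory δ A p.1.1 p.1.2 t ht p.2 := by
  induction t with
  | zero => exact measurable_const
  | succ t ih =>
    have hpast : Measurable fun p : (A.Ω × (Fin T → Dir K)) × (Fin (t + 1) → ℝ) =>
        baseHistory δ A p.1.1 p.1.2 t (Nat.le_of_succ_le ht) (fun s => p.2 s.castSucc) :=
      (ih (Nat.le_of_succ_le ht)).comp (g := fun p : (A.Ω × (Fin T → Dir K)) × (Fin t → ℝ) =>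
        baseHistory δ A p.1.1 p.1.2 t (Nat.le_of_succ_le ht) p.2)
        (f := fun p : (A.Ω × (Fin T → Dir K)) × (Fin (t + 1) → ℝ) =>
          (p.1, fun s : Fin t => p.2 s.castSucc))
        (measurable_fst.prodMk (measurable_pi_lambda _ fun s =>
          (measurable_pi_apply s.castSucc).comp measurable_snd))
    have hact := (A.measurable_act ⟨t, ht⟩).comp
      ((measurable_fst.comp measurable_fst).prodMk hpast)
    have hv : Measurable fun p : (A.Ω × (Fin T → Dir K)) × (Fin (t + 1) → ℝ) =>
        ((p.1.2 ⟨t, ht⟩ : vectorSpan ℝ K) : EuclideanSpace ℝ (Fin d)) :=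
      measurable_subtype_coe.comp (measurable_subtype_coe.comp
        ((measurable_pi_apply _).comp (measurable_snd.comp measurable_fst)))
    have ho : Measurable fun p : (A.Ω × (Fin T → Dir K)) × (Fin (t + 1) → ℝ) =>
        (Module.finrank ℝ (vectorSpan ℝ K) : ℝ) / δ * p.2 (Fin.last t) :=
      ((measurable_pi_apply _).comp measurable_snd).const_mul _
    refine measurable_pi_lambda _ fun s => ?_
    refine Fin.lastCases ?_ (fun s => ?_) s
    · simp only [baseHistory, Fin.snoc_last]
      exact hact.prodMk (ho.smul hv)
    · simp only [baseHistory, Fin.snoc_castSucc]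
      exact (measurable_pi_apply s).comp hpast

/-- The meta-algorithm `STB(A)`. Its randomness is that of `A` together with independent uniform
directions, one for each round. In round `t` it plays `x + δ v`, where `x` is the action of `A` and
`v` the direction sampled for this round; its history is turned into the history of `A` by
`baseHistory`. -/
def STB (h : Admissible K c r α δ) (A : Agent T (shrunk K c r α) (EuclideanSpace ℝ (Fin d))) :
    Agent T K ℝ :=
  haveI := h.nontrivial_vectorSpan
  haveI := isProbabilityMeasure_unifSphere (vectorSpan ℝ K)
  { Ω := A.Ω × (Fin T → Dir K)
    P := A.P.prod (Measure.pi fun _ => unifSphere (vectorSpan ℝ K))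
    act := fun t p H =>
      ⟨(A.act t p.1 (baseHistory δ A p.1 p.2 t t.2.le fun s => (H s).2) :
            EuclideanSpace ℝ (Fin d))
          + δ • ((p.2 t : vectorSpan ℝ K) : EuclideanSpace ℝ (Fin d)),
        h.add_mem (Subtype.prop _) _ (mem_sphere_zero_iff_norm.1 (p.2 t).2).le⟩
    measurable_act := fun t => by
      have hH : Measurable fun p : (A.Ω × (Fin T → Dir K)) × (Fin t → K × ℝ) =>
          baseHistory δ A p.1.1 p.1.2 t t.2.le fun s => (p.2 s).2 :=
        (measurable_baseHistory δ A t t.2.le).comp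
          (f := fun p : (A.Ω × (Fin T → Dir K)) × (Fin t → K × ℝ) =>
            (p.1, fun s : Fin t => (p.2 s).2))
          (measurable_fst.prodMk (measurable_pi_lambda _ fun s =>
            measurable_snd.comp ((measurable_pi_apply s).comp measurable_snd)))
      have hact := (A.measurable_act t).comp
        ((measurable_fst.comp measurable_fst).prodMk hH)
      have hv : Measurable fun p : (A.Ω × (Fin T → Dir K)) × (Fin t → K × ℝ) =>
          ((p.1.2 t : vectorSpan ℝ K) : EuclideanSpace ℝ (Fin d)) :=
        measurable_subtype_coe.comp (measurable_subtype_coe.comp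
          ((measurable_pi_apply _).comp (measurable_snd.comp measurable_fst)))
      exact Measurable.subtype_mk ((measurable_subtype_coe.comp hact).add (hv.const_smul δ)) }

end Smoothing

end OnlineOpt

end

open OnlineOpt

/-! Two facts carry the reduction. The analytic one is that smoothing a merely continuous `f` over
balls of radius δ gives a differentiable function whose gradient at `x` is the mean of `(k / δ) f(x
+ δ v) v` over the unit sphere (`isGradientAt_smoothed`). Hence `(k / δ) o v`, with `o` an unbiased
answer at `x + δ v`, is an unbiased answer of a gradient oracle for the smoothed loss, with norm `(k
/ δ) |o|` (`smooth_mem_advOne`). Convexity plays no part here. The formula is the divergence theorem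
on a ball, `setIntegral_closedBall_translate_sub`; as `f` has no derivative, it is tested against
radial kernels, onto which the derivative is moved.

The probabilistic one is that the base algorithm inside `STB`, although all directions are drawn
before the game, sees exactly the law of its own game against the smoothed adversary (`map_stbLaw`):
the direction of a round is still independent of the past when that round begins. On the same
probability space the point played is a δ-perturbation of the base action (`ae_stbLaw_play`).

What remains is a comparison of losses round by round (`realizedRegret_STB_le`). If δ-perturbations
change a loss by at most ε and shrinking a comparator raises it by at most η, the price per round is
`3 ε + η`: 2ε for the played point against the smoothed loss at the base action, `ε + η` for the
comparator. Convexity gives ε = (δ/α)·osc and η = (α/r)·osc, where osc bounds the oscillation;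
Lipschitz continuity gives ε = M₁δ and η = 2DM₁α/r. -/

noncomputable section

namespace OnlineOpt

/-! ### The divergence theorem on Euclidean balls -/

section Divergence

open scoped ContDiff

variable {E : Type*} [NormedAddCommGroup E] [InnerProductSpace ℝ E] [FiniteDimensional ℝ E]
  [MeasurableSpace E] [BorelSpace E]

/-- Integration in polar coordinates. -/
theorem integral_eq_integral_toSphere [Nontrivial E] {g : E → ℝ} (hg : Integrable g) :
    ∫ x, g x = ∫ r in Set.Ioi (0 : ℝ), r ^ (Module.finrank ℝ E - 1) *
      ∫ v, g (r • (v : E)) ∂(volume : Measure E).toSphere := by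
  set μ : Measure E := volume
  have hmp := μ.measurePreserving_homeomorphUnitSphereProd
  have hemb := (homeomorphUnitSphereProd E).measurableEmbedding
  let G : Metric.sphere (0 : E) 1 × Set.Ioi (0 : ℝ) → ℝ := fun p => g ((p.2 : ℝ) • (p.1 : E))
  have hG : ∀ x : ({(0)}ᶜ : Set E), G (homeomorphUnitSphereProd E x) = g x := by
    intro x
    have : (‖(x : E)‖ : ℝ) ≠ 0 := norm_ne_zero_iff.2 x.2
    simp [G, homeomorphUnitSphereProd, smul_smul, this]
  have hint : Integrable G (μ.toSphere.prod (.volumeIoiPow (Module.finrank ℝ E - 1))) := by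
    rw [← hmp.integrable_comp_emb hemb]
    have : G ∘ homeomorphUnitSphereProd E = fun x : ({(0)}ᶜ : Set E) => g x := funext hG
    rw [this]
    have := (MeasurableEmbedding.subtype_coe
      (measurableSet_singleton (0 : E)).compl).integrableOn_range_iff_comap (μ := μ) (f := g)
    exact this.1 hg.integrableOn
  calc
    ∫ x, g x = ∫ x : ({(0)}ᶜ : Set E), g x ∂(μ.comap (↑)) := by
      rw [integral_subtype_comap (measurableSet_singleton _).compl fun x ↦ g x,
        restrict_compl_singleton]
    _ = ∫ p, G p ∂μ.toSphere.prod (.volumeIoiPow (Module.finrank ℝ E - 1)) := by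
      rw [← hmp.integral_comp hemb]
      exact integral_congr_ae (.of_forall fun x => (hG x).symm)
    _ = ∫ r : Set.Ioi (0 : ℝ), ∫ v, G (v, r) ∂μ.toSphere
          ∂.volumeIoiPow (Module.finrank ℝ E - 1) := integral_prod_symm _ hint
    _ = _ := by
      simp only [Measure.volumeIoiPow, ENNReal.ofReal]
      rw [integral_withDensity_eq_integral_smul,
        integral_subtype_comap measurableSet_Ioi fun a ↦
          Real.toNNReal (a ^ (Module.finrank ℝ E - 1)) • ∫ v, g (a • (v : E)) ∂μ.toSphere,
        setIntegral_congr_fun measurableSet_Ioi fun x hx ↦ ?_]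
      · simp only [NNReal.smul_def]
        rw [Real.coe_toNNReal _ (pow_nonneg hx.out.le _), smul_eq_mul]
      · exact (measurable_subtype_coe.pow_const _).real_toNNReal

theorem setIntegral_closedBall_eq_integral_toSphere [Nontrivial E] {g : E → ℝ}
    (hg : Continuous g) {R : ℝ} (hR : 0 ≤ R) :
    ∫ x in Metric.closedBall (0 : E) R, g x = ∫ r in (0 : ℝ)..R, r ^ (Module.finrank ℝ E - 1) *
      ∫ v, g (r • (v : E)) ∂(volume : Measure E).toSphere := by
  have hm : MeasurableSet (Metric.closedBall (0 : E) R) := Metric.isClosed_closedBall.measurableSet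
  have hi : Integrable ((Metric.closedBall (0 : E) R).indicator g) := by
    rw [integrable_indicator_iff hm]
    exact hg.continuousOn.integrableOn_compact (isCompact_closedBall _ _)
  rw [← integral_indicator hm, integral_eq_integral_toSphere hi,
    intervalIntegral.integral_of_le hR, ← Set.Ioi_inter_Iic,
    ← setIntegral_indicator measurableSet_Iic]
  refine setIntegral_congr_fun measurableSet_Ioi fun r hr => ?_
  have hr : 0 < r := hr
  by_cases h : r ≤ R
  · rw [Set.indicator_of_mem (show r ∈ Set.Iic R from h)]
    congr 1
    refine integral_congr_ae (.of_forall fun v => Set.indicator_of_mem ?_ _)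
    simpa [norm_smul, abs_of_pos hr] using h
  · rw [Set.indicator_of_notMem (show r ∉ Set.Iic R from h)]
    have : ∀ v : Metric.sphere (0 : E) 1,
        (Metric.closedBall (0 : E) R).indicator g (r • (v : E)) = 0 := fun v =>
      Set.indicator_of_notMem (by simpa [norm_smul, abs_of_pos hr] using h) _
    simp [this]

theorem integral_eq_intervalIntegral_toSphere [Nontrivial E] {g : E → ℝ} (hg : Continuous g) {R : ℝ}
    (hR : 0 ≤ R) (h0 : ∀ x, R ≤ ‖x‖ → g x = 0) :
    ∫ x, g x = ∫ r in (0 : ℝ)..R, r ^ (Module.finrank ℝ E - 1) *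
      ∫ v, g (r • (v : E)) ∂(volume : Measure E).toSphere := by
  rw [← setIntegral_closedBall_eq_integral_toSphere hg hR]
  refine (setIntegral_eq_integral_of_forall_compl_eq_zero fun x hx => h0 x ?_).symm
  exact (not_le.1 fun h => hx (mem_closedBall_zero_iff.2 h)).le

/-- A continuous function smoothed by a radial kernel: the fundamental theorem of calculus along
the segment from `0` to `w`. -/
theorem integral_sub_mul_radial {F : E → ℝ} (hF : Continuous F) (w : E) {χ : ℝ → ℝ}
    (hχ : ContDiff ℝ 1 χ) {R : ℝ} (hR : 0 ≤ R) (h0 : ∀ ρ, R ^ 2 ≤ ρ → χ ρ = 0) :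
    ∫ u, (F (w + u) - F u) * χ (‖u‖ ^ 2)
      = ∫ s in (0 : ℝ)..1, ∫ u, F (s • w + u) * (-(2 * deriv χ (‖u‖ ^ 2) * ⟪u, w⟫_ℝ)) := by
  let Φ : E → ℝ := fun u => χ (‖u‖ ^ 2)
  have hΦ : ContDiff ℝ 1 Φ := hχ.comp (contDiff_norm_sq ℝ)
  have hΦ' : ∀ u v, fderiv ℝ Φ u v = 2 * deriv χ (‖u‖ ^ 2) * ⟪u, v⟫_ℝ := by
    intro u v
    have h1 : HasFDerivAt (fun u : E => ‖u‖ ^ 2) (2 • (innerSL ℝ u)) u :=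
      (hasStrictFDerivAt_norm_sq u).hasFDerivAt
    have h2 := ((hχ.differentiable one_ne_zero) (‖u‖ ^ 2)).hasDerivAt.comp_hasFDerivAt u h1
    have h3 : fderiv ℝ Φ u = _ := h2.fderiv
    rw [h3]
    simp
    ring
  have hcs : HasCompactSupport Φ := by
    refine HasCompactSupport.of_support_subset_isCompact (isCompact_closedBall (0 : E) R) ?_
    intro u hu
    by_contra hc
    rw [mem_closedBall_zero_iff, not_le] at hc
    exact hu (h0 _ (by gcongr))
  have hloc : LocallyIntegrable F (volume : Measure E) := hF.locallyIntegrable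
  let L := ContinuousLinearMap.mul ℝ ℝ
  let g : E → ℝ := convolution F Φ L volume
  have hg : ∀ z, g z = ∫ u, F (z + u) * Φ u := by
    intro z
    have : g z = ∫ t, F t * Φ (z - t) := rfl
    rw [this, ← integral_add_left_eq_self _ z]
    refine integral_congr_ae (.of_forall fun u => ?_)
    simp [Φ]
  have hgd : ContDiff ℝ 1 g := hcs.contDiff_convolution_right (n := 1) L hloc hΦ
  -- The derivative falls on `Φ` alone, since `F` is only continuous. After the translation `t = z +
  -- u` it is evaluated at `-u`, which produces the minus sign.
  have hgf : ∀ z, fderiv ℝ g z w = ∫ u, F (z + u) * (-(2 * deriv χ (‖u‖ ^ 2) * ⟪u, w⟫_ℝ)) := by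
    intro z
    rw [(hcs.hasFDerivAt_convolution_right L hloc hΦ z).fderiv,
      convolution_precompR_apply L hloc (hcs.fderiv ℝ) (hΦ.continuous_fderiv one_ne_zero)]
    have : (convolution F (fun a => fderiv ℝ Φ a w) L volume) z
      = ∫ t, F t * fderiv ℝ Φ (z - t) w := rfl
    rw [this, ← integral_add_left_eq_self _ z]
    refine integral_congr_ae (.of_forall fun u => ?_)
    simp [hΦ', inner_neg_left]
  have hder : ∀ s : ℝ, HasDerivAt (fun s : ℝ => g (s • w)) (fderiv ℝ g (s • w) w) s := by
    intro s
    have h1 : HasDerivAt (fun s : ℝ => s • w) w s := by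
      simpa using (hasDerivAt_id s).smul_const w
    exact ((hgd.differentiable one_ne_zero) (s • w)).hasFDerivAt.comp_hasDerivAt s h1
  have hcont : Continuous fun s : ℝ => fderiv ℝ g (s • w) w :=
    ((hgd.continuous_fderiv one_ne_zero).comp (continuous_id.smul continuous_const)).clm_apply
      continuous_const
  have key := intervalIntegral.integral_eq_sub_of_hasDerivAt (a := 0) (b := 1)
    (fun s _ => hder s) (hcont.intervalIntegrable _ _)
  simp only [hgf] at key
  rw [key, one_smul, zero_smul, hg, hg, ← integral_sub]
  · simp only [zero_add, sub_mul, Φ]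
  · exact ((hF.comp (continuous_const.add continuous_id)).mul
      hΦ.continuous).integrable_of_hasCompactSupport hcs.mul_left
  · exact ((hF.comp (continuous_const.add continuous_id)).mul
      hΦ.continuous).integrable_of_hasCompactSupport hcs.mul_left

/-- The substitution `ρ = r ^ 2` reduces this to the fundamental lemma of the calculus of
variations, and continuity turns almost everywhere into everywhere. Tests in `r ^ 2` are the ones
needed, because radial kernels `χ (‖u‖ ^ 2)` are differentiable also at the origin. -/
theorem eq_zero_of_forall_integral_sq_eq_zero {h : ℝ → ℝ} (hh : Continuous h)
    (H : ∀ ψ : ℝ → ℝ, ContDiff ℝ ∞ ψ → HasCompactSupport ψ →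
      ∫ r in Set.Ioi (0 : ℝ), 2 * r * (ψ (r ^ 2) * h r) = 0) {δ : ℝ} (hδ : 0 < δ) : h δ = 0 := by
  let f : ℝ → ℝ := (Set.Ioi (0 : ℝ)).indicator fun ρ => h (√ρ)
  have hc : Continuous fun ρ => h (√ρ) := hh.comp Real.continuous_sqrt
  have hf : LocallyIntegrable f volume := by
    have := (hc.locallyIntegrable (μ := volume))
    exact this.indicator measurableSet_Ioi
  have hae := ae_eq_zero_of_integral_contDiff_smul_eq_zero hf fun ψ hψ hψc => by
    rw [← H ψ hψ hψc]
    have h1 : ∀ ρ, ψ ρ • f ρ = (Set.Ioi (0 : ℝ)).indicator (fun ρ => ψ ρ * h (√ρ)) ρ := by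
      intro ρ
      by_cases hρ : ρ ∈ Set.Ioi (0 : ℝ) <;> simp [f, hρ]
    simp only [h1]
    rw [integral_indicator measurableSet_Ioi, ← integral_comp_rpow_Ioi_of_pos (p := 2) two_pos]
    refine setIntegral_congr_fun measurableSet_Ioi fun r hr => ?_
    have hr : 0 ≤ r := hr.le
    norm_num [Real.sqrt_sq hr]
  have hae2 : ∀ᵐ ρ ∂(volume.restrict (Set.Ioi (0 : ℝ))), h (√ρ) = 0 := by
    rw [ae_restrict_iff' measurableSet_Ioi]
    filter_upwards [hae] with ρ h1 h2
    simpa [f, h2] using h1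
  have := Measure.eqOn_open_of_ae_eq (f := fun ρ => h (√ρ)) (g := fun _ => 0) hae2 isOpen_Ioi
    hc.continuousOn continuousOn_const
  have h3 := this (show δ ^ 2 ∈ Set.Ioi (0 : ℝ) from by simpa using pow_pos hδ 2)
  simpa [Real.sqrt_sq hδ.le] using h3

theorem continuous_integral_toSphere {X : Type*} [TopologicalSpace X] [FirstCountableTopology X]
    [LocallyCompactSpace X] {f : X → Metric.sphere (0 : E) 1 → ℝ} (hf : Continuous f.uncurry) :
    Continuous fun x => ∫ v, f x v ∂(volume : Measure E).toSphere := by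
  simpa using continuous_parametric_integral_of_continuous
    (μ := (volume : Measure E).toSphere) hf isCompact_univ

/-- The divergence theorem on a ball for translates of a continuous function, integrated along the
segment from `0` to `w`. -/
theorem setIntegral_closedBall_translate_sub [Nontrivial E] {F : E → ℝ} (hF : Continuous F) (w : E)
    {δ : ℝ} (hδ : 0 < δ) :
    ∫ u in Metric.closedBall (0 : E) δ, (F (w + u) - F u)
      = δ ^ (Module.finrank ℝ E - 1) * ∫ s in (0 : ℝ)..1,
          ∫ v, F (s • w + δ • (v : E)) * ⟪(v : E), w⟫_ℝ ∂(volume : Measure E).toSphere := by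
  set k := Module.finrank ℝ E - 1
  let σ := (volume : Measure E).toSphere
  -- Here `k` is the dimension minus one. With `δ` replaced by a variable radius `r`, the left side
  -- is `N r` and the right side is `r ^ k * Q r`; both are continuous in `r`, so they may be
  -- compared after integration against test functions.
  let n : ℝ → ℝ := fun r => r ^ k * ∫ v, (F (w + r • (v : E)) - F (r • (v : E))) ∂σ
  let q : ℝ → ℝ → ℝ := fun s r => ∫ v, F (s • w + r • (v : E)) * ⟪(v : E), w⟫_ℝ ∂σ
  let N : ℝ → ℝ := fun r => ∫ p in (0 : ℝ)..r, n p
  let Q : ℝ → ℝ := fun r => ∫ s in (0 : ℝ)..1, q s r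
  have hn : Continuous n := (continuous_id.pow k).mul (continuous_integral_toSphere (by fun_prop))
  have hq : Continuous fun p : ℝ × ℝ => q p.1 p.2 :=
    continuous_integral_toSphere (X := ℝ × ℝ)
      (f := fun p (v : Metric.sphere (0 : E) 1) => F (p.1 • w + p.2 • (v : E)) * ⟪(v : E), w⟫_ℝ)
      (by fun_prop)
  have hNd : ∀ r, HasDerivAt N (n r) r := fun r =>
    intervalIntegral.integral_hasDerivAt_right (hn.intervalIntegrable _ _)
      (hn.stronglyMeasurableAtFilter _ _) hn.continuousAt
  have hN : Continuous N := continuous_iff_continuousAt.2 fun r => (hNd r).continuousAt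
  have hQ : Continuous Q :=
    intervalIntegral.continuous_parametric_intervalIntegral_of_continuous' (f := fun r s => q s r)
      (hq.comp continuous_swap) 0 1
  have hh : Continuous fun r => N r - r ^ k * Q r := hN.sub ((continuous_id.pow k).mul hQ)
  have hF' : Continuous fun u => F (w + u) - F u := by fun_prop
  have h1 : ∫ u in Metric.closedBall (0 : E) δ, (F (w + u) - F u) = N δ :=
    setIntegral_closedBall_eq_integral_toSphere hF' hδ.le
  rw [h1]
  refine sub_eq_zero.1 (eq_zero_of_forall_integral_sq_eq_zero hh (fun ψ hψ hψc => ?_) hδ)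
  obtain ⟨R, hR, hψR⟩ : ∃ R : ℝ, 0 ≤ R ∧ ∀ ρ, R ^ 2 ≤ ρ → ψ ρ = 0 := by
    obtain ⟨C, hC⟩ := hψc.isCompact.isBounded.exists_norm_le
    refine ⟨|C| + 1, by positivity, fun ρ hρ => ?_⟩
    by_contra hne
    have h2 := hC ρ (subset_tsupport _ hne)
    have h3 := le_abs_self ρ
    have h4 := le_abs_self C
    rw [Real.norm_eq_abs] at h2
    nlinarith [abs_nonneg C]
  -- The antiderivative of `-ψ` that vanishes from `R ^ 2` on: the kernel `χ (‖u‖ ^ 2)` then has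
  -- compact support, and the boundary term at `R` below disappears.
  let χ : ℝ → ℝ := fun ρ => -∫ p in (R ^ 2)..ρ, ψ p
  have hχd : ∀ ρ, HasDerivAt χ (-ψ ρ) ρ := fun ρ =>
    (intervalIntegral.integral_hasDerivAt_right (hψ.continuous.intervalIntegrable _ _)
      (hψ.continuous.stronglyMeasurableAtFilter _ _) hψ.continuous.continuousAt).neg
  have hχ' : deriv χ = fun ρ => -ψ ρ := funext fun ρ => (hχd ρ).deriv
  have hχ : ContDiff ℝ 1 χ := by
    rw [contDiff_one_iff_deriv, hχ']
    exact ⟨fun ρ => (hχd ρ).differentiableAt, hψ.continuous.neg⟩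
  have hχ0 : ∀ ρ, R ^ 2 ≤ ρ → χ ρ = 0 := by
    intro ρ hρ
    simp only [χ, neg_eq_zero]
    refine intervalIntegral.integral_zero_ae (.of_forall fun p hp => hψR p ?_)
    rw [Set.uIoc_of_le hρ] at hp
    exact hp.1.le
  have key := integral_sub_mul_radial hF w hχ hR hχ0
  have hψsq : Continuous fun r : ℝ => 2 * r * ψ (r ^ 2) :=
    (continuous_const.mul continuous_id).mul (hψ.continuous.comp (continuous_pow 2))
  have hleft : ∫ u, (F (w + u) - F u) * χ (‖u‖ ^ 2)
      = ∫ r in (0 : ℝ)..R, N r * (2 * r * ψ (r ^ 2)) := by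
    have hc : Continuous fun u : E => (F (w + u) - F u) * χ (‖u‖ ^ 2) :=
      hF'.mul (hχ.continuous.comp (continuous_norm.pow 2))
    rw [integral_eq_intervalIntegral_toSphere hc hR
      fun x hx => by rw [hχ0 _ (by gcongr), mul_zero]]
    have hd : ∀ r : ℝ, HasDerivAt (fun r : ℝ => χ (r ^ 2)) (-(2 * r * ψ (r ^ 2))) r := by
      intro r
      have := (hχd (r ^ 2)).comp r (hasDerivAt_pow 2 r)
      exact this.congr_deriv (by push_cast; ring)
    -- In polar coordinates the integral is that of `N' r * χ (r ^ 2)`. Integration by parts leaves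
    -- no boundary terms, as `χ (R ^ 2) = 0` and `N 0 = 0`.
    have hparts := intervalIntegral.integral_mul_deriv_eq_deriv_mul (a := 0) (b := R)
      (fun r _ => hNd r) (fun r _ => hd r) (hn.intervalIntegrable _ _)
      (hψsq.neg.intervalIntegrable _ _)
    rw [hχ0 (R ^ 2) le_rfl, show N 0 = 0 from intervalIntegral.integral_same] at hparts
    simp only [mul_neg, intervalIntegral.integral_neg, mul_zero, zero_mul, sub_zero, zero_sub,
      neg_inj] at hparts
    rw [hparts]
    refine intervalIntegral.integral_congr fun r _ => ?_
    have hv : ∀ v : Metric.sphere (0 : E) 1, ‖r • (v : E)‖ ^ 2 = r ^ 2 := fun v => by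
      simp [norm_smul]
    simp only [hv, integral_mul_const, n]
    ring
  have hright : ∫ s in (0 : ℝ)..1, ∫ u, F (s • w + u) * (-(2 * deriv χ (‖u‖ ^ 2) * ⟪u, w⟫_ℝ))
      = ∫ r in (0 : ℝ)..R, r ^ k * Q r * (2 * r * ψ (r ^ 2)) := by
    have h2 : ∀ s : ℝ, ∫ u, F (s • w + u) * (-(2 * deriv χ (‖u‖ ^ 2) * ⟪u, w⟫_ℝ))
        = ∫ r in (0 : ℝ)..R, r ^ k * q s r * (2 * r * ψ (r ^ 2)) := by
      intro s
      simp only [hχ']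
      rw [integral_eq_intervalIntegral_toSphere _ hR
        fun x hx => by rw [hψR _ (by gcongr)]; ring]
      · refine intervalIntegral.integral_congr fun r _ => ?_
        have hv : ∀ v : Metric.sphere (0 : E) 1,
            F (s • w + r • (v : E)) * (-(2 * -ψ (‖r • (v : E)‖ ^ 2) * ⟪r • (v : E), w⟫_ℝ))
              = F (s • w + r • (v : E)) * ⟪(v : E), w⟫_ℝ * (2 * r * ψ (r ^ 2)) := fun v => by
          have : ‖r • (v : E)‖ ^ 2 = r ^ 2 := by simp [norm_smul]
          rw [this, real_inner_smul_left]
          ring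
        rw [integral_congr_ae (.of_forall hv), integral_mul_const]
        simp only [q, σ, k, mul_assoc]
      · have := hψ.continuous
        fun_prop
    simp only [h2]
    rw [intervalIntegral_intervalIntegral_swap]
    · refine intervalIntegral.integral_congr fun r _ => ?_
      simp only [Q, intervalIntegral.integral_mul_const, intervalIntegral.integral_const_mul]
    · have hc : Continuous fun p : ℝ × ℝ => p.2 ^ k * q p.1 p.2 * (2 * p.2 * ψ (p.2 ^ 2)) :=
        ((continuous_snd.pow k).mul hq).mul (hψsq.comp continuous_snd)
      exact (hc.continuousOn.integrableOn_compact (isCompact_uIcc.prod isCompact_uIcc)).mono_set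
        (Set.prod_mono Set.uIoc_subset_uIcc Set.uIoc_subset_uIcc)
  rw [hleft, hright] at key
  have hsub : ∫ r in (0 : ℝ)..R, 2 * r * (ψ (r ^ 2) * (N r - r ^ k * Q r)) = 0 := by
    have hc1 : Continuous fun r => N r * (2 * r * ψ (r ^ 2)) := hN.mul hψsq
    have hc2 : Continuous fun r => r ^ k * Q r * (2 * r * ψ (r ^ 2)) :=
      ((continuous_id.pow k).mul hQ).mul hψsq
    rw [← sub_eq_zero, ← intervalIntegral.integral_sub (hc1.intervalIntegrable _ _)
      (hc2.intervalIntegrable _ _)] at key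
    refine Eq.trans ?_ key
    refine intervalIntegral.integral_congr fun r _ => ?_
    ring
  rw [intervalIntegral.integral_of_le hR] at hsub
  refine Eq.trans ?_ hsub
  -- Beyond `R` the test function vanishes, so the half-line may be cut at `R`.
  refine setIntegral_eq_of_subset_of_forall_sdiff_eq_zero measurableSet_Ioi
    Set.Ioc_subset_Ioi_self fun r hr => ?_
  have hr1 : R < r := not_le.1 fun h => hr.2 ⟨hr.1, h⟩
  rw [hψR (r ^ 2) (by gcongr)]
  ring

end Divergence

/-! ### Uniform distributions on the ball and the sphere -/

section Uniform

variable {L : Type} [NormedAddCommGroup L] [InnerProductSpace ℝ L] [FiniteDimensional ℝ L]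
  [MeasurableSpace L] [BorelSpace L]

instance isProbabilityMeasure_unifBall : IsProbabilityMeasure (unifBall L) := by
  have hm : MeasurableSet (Metric.closedBall (0 : L) 1) := Metric.isClosed_closedBall.measurableSet
  have h0 : (volume : Measure L) (Metric.closedBall 0 1) ≠ 0 :=
    (Metric.measure_closedBall_pos _ _ one_pos).ne'
  have ht : (volume : Measure L) (Metric.closedBall 0 1) ≠ ⊤ := measure_closedBall_lt_top.ne
  constructor
  rw [unifBall, (MeasurableEmbedding.subtype_coe hm).comap_apply, Set.image_univ,
    Subtype.range_coe, cond_apply hm, Set.inter_self]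
  exact ENNReal.inv_mul_cancel h0 ht

theorem integral_unifBall (g : L → ℝ) :
    ∫ v, g v ∂(unifBall L) = ((volume : Measure L).real (Metric.closedBall 0 1))⁻¹ *
      ∫ v in Metric.closedBall (0 : L) 1, g v := by
  have hm : MeasurableSet (Metric.closedBall (0 : L) 1) := Metric.isClosed_closedBall.measurableSet
  rw [unifBall, integral_subtype_comap hm g, ProbabilityTheory.cond, Measure.restrict_smul,
    integral_smul_measure, Measure.restrict_restrict hm, Set.inter_self, smul_eq_mul,
    ENNReal.toReal_inv, measureReal_def]

/-- The area of the unit sphere is the dimension times the volume of the unit ball; this is the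
source of the factor `k` in the gradient estimate. -/
theorem integral_unifSphere (g : Metric.sphere (0 : L) 1 → ℝ) :
    ∫ v, g v ∂(unifSphere L) =
      ((Module.finrank ℝ L : ℝ) * (volume : Measure L).real (Metric.closedBall 0 1))⁻¹ *
        ∫ v, g v ∂(volume : Measure L).toSphere := by
  rw [unifSphere, integral_smul_measure, smul_eq_mul, ENNReal.toReal_inv,
    ← measureReal_def, Measure.toSphere_real_apply_univ]
  congr 3
  rw [measureReal_def, measureReal_def, Measure.addHaar_unitClosedBall_eq_addHaar_unitBall]

/-- The average over balls of a continuous function changes along a segment at the rate given by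
averages over spheres. -/
theorem integral_unifBall_translate_sub [Nontrivial L] {F : L → ℝ} (hF : Continuous F) (w : L)
    {δ : ℝ} (hδ : 0 < δ) :
    ∫ v, F (w + δ • (v : L)) ∂(unifBall L) - ∫ v, F (δ • (v : L)) ∂(unifBall L)
      = ∫ s in (0 : ℝ)..1, (Module.finrank ℝ L : ℝ) / δ *
          ∫ v, F (s • w + δ • (v : L)) * ⟪(v : L), w⟫_ℝ ∂(unifSphere L) := by
  have hV : (volume : Measure L).real (Metric.closedBall 0 1) ≠ 0 :=
    (ENNReal.toReal_pos (Metric.measure_closedBall_pos _ _ one_pos).ne'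
      measure_closedBall_lt_top.ne).ne'
  have hk : 0 < Module.finrank ℝ L := Module.finrank_pos
  have hscale : δ ^ Module.finrank ℝ L *
      ∫ v in Metric.closedBall (0 : L) 1, (F (w + δ • v) - F (δ • v))
      = ∫ u in Metric.closedBall (0 : L) δ, (F (w + u) - F u) := by
    have := Measure.setIntegral_comp_smul_of_pos (volume : Measure L) (fun u => F (w + u) - F u)
      (Metric.closedBall (0 : L) 1) hδ
    rw [this, smul_closedBall _ _ zero_le_one]
    simp only [smul_zero, mul_one, smul_eq_mul, Real.norm_of_nonneg hδ.le]
    rw [mul_inv_cancel_left₀ (pow_pos hδ _).ne']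
  have hi : ∀ g : L → ℝ, Continuous g → IntegrableOn g (Metric.closedBall (0 : L) 1) :=
    fun g hg => hg.continuousOn.integrableOn_compact (isCompact_closedBall _ _)
  rw [integral_unifBall (fun v => F (w + δ • v)), integral_unifBall (fun v => F (δ • v)),
    ← mul_sub, ← integral_sub (hi _ (by fun_prop)) (hi _ (by fun_prop))]
  rw [setIntegral_closedBall_translate_sub hF w hδ] at hscale
  simp only [integral_unifSphere, intervalIntegral.integral_const_mul]
  -- Volume scales as `δ ^ k` and area as `δ ^ (k - 1)`; their quotient is the `1 / δ` of the
  -- estimate.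
  have hpow : δ ^ Module.finrank ℝ L = δ ^ (Module.finrank ℝ L - 1) * δ := by
    rw [← pow_succ, Nat.sub_add_cancel hk]
  rw [hpow, mul_assoc] at hscale
  have h2 := mul_left_cancel₀ (pow_pos hδ _).ne' hscale
  rw [← h2]
  have hk' : (Module.finrank ℝ L : ℝ) ≠ 0 := by exact_mod_cast hk.ne'
  field_simp

end Uniform

/-! ### The gradient of the smoothed function -/

section Gradient

variable {d : ℕ} {K : Set (EuclideanSpace ℝ (Fin d))} {c : EuclideanSpace ℝ (Fin d)} {r α δ : ℝ}

theorem Admissible.smoothing_pos (h : Admissible K c r α δ) : 0 < α := h.δ_pos.trans_le h.δ_le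

theorem Admissible.ratio_lt_one (h : Admissible K c r α δ) : α / r < 1 :=
  (div_lt_one h.r_pos).2 h.α_lt

theorem Admissible.shrunk_subset (h : Admissible K c r α δ) : shrunk K c r α ⊆ K := fun x hx => by
  simpa using h.add_mem hx 0 (by simp)

theorem Admissible.convex_shrunk (h : Admissible K c r α δ) : Convex ℝ (shrunk K c r α) := by
  have := h.convex.affinity ((α / r) • c) (1 - α / r)
  simpa only [shrunk, add_comm] using this

/-- Shrinking multiplies differences by `1 - α / r ≠ 0`. This is needed because the averages over
directions of `K` have to qualify as gradients on the shrunk domain. -/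
theorem Admissible.vectorSpan_le (h : Admissible K c r α δ) :
    vectorSpan ℝ K ≤ vectorSpan ℝ (shrunk K c r α) := by
  rw [vectorSpan, Submodule.span_le]
  rintro _ ⟨a, ha, b, hb, rfl⟩
  have hmem := vsub_mem_vectorSpan ℝ (Set.mem_image_of_mem
    (fun y => (1 - α / r) • y + (α / r) • c) ha) (Set.mem_image_of_mem
    (fun y => (1 - α / r) • y + (α / r) • c) hb)
  have h1 : (1 - α / r) ≠ 0 := (sub_pos.2 h.ratio_lt_one).ne'
  have := Submodule.smul_mem _ (1 - α / r)⁻¹ hmem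
  simp only [vsub_eq_sub, add_sub_add_right_eq_sub, ← smul_sub] at this
  rwa [inv_smul_smul₀ h1] at this

/-- The point `x + δ v` of `K`, for `x` in the shrunk domain and `v` in the unit sphere. -/
def perturb (h : Admissible K c r α δ) (x : shrunk K c r α) (v : Dir K) : K :=
  ⟨(x : EuclideanSpace ℝ (Fin d)) + δ • ((v : vectorSpan ℝ K) : EuclideanSpace ℝ (Fin d)),
    h.add_mem x.2 _ (mem_sphere_zero_iff_norm.1 v.2).le⟩

theorem continuous_perturb (h : Admissible K c r α δ) :
    Continuous fun p : shrunk K c r α × Dir K => perturb h p.1 p.2 := by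
  unfold perturb
  fun_prop

/-- The gradient of the smoothed function: the average of `(k / δ) f(x + δ v) v` over the unit
sphere. -/
def smoothedGrad (h : Admissible K c r α δ) (f : K → ℝ) (x : shrunk K c r α) : vectorSpan ℝ K :=
  ∫ v, ((Module.finrank ℝ (vectorSpan ℝ K) : ℝ) / δ * f (perturb h x v)) • (v : vectorSpan ℝ K)
    ∂(unifSphere (vectorSpan ℝ K))

theorem continuous_smoothedGrad (h : Admissible K c r α δ) {f : K → ℝ} (hf : Continuous f) {B : ℝ}
    (hB : ∀ x, |f x| ≤ B) : Continuous (smoothedGrad h f) := by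
  have := h.nontrivial_vectorSpan
  have := isProbabilityMeasure_unifSphere (vectorSpan ℝ K)
  have hc : Continuous fun p : shrunk K c r α × Dir K =>
      ((Module.finrank ℝ (vectorSpan ℝ K) : ℝ) / δ * f (perturb h p.1 p.2)) •
        (p.2 : vectorSpan ℝ K) :=
    (continuous_const.mul (hf.comp (continuous_perturb h))).smul
      (continuous_subtype_val.comp continuous_snd)
  refine continuous_of_dominated
    (bound := fun _ => (Module.finrank ℝ (vectorSpan ℝ K) : ℝ) / δ * B) (fun x => ?_)
    (fun x => .of_forall fun v => ?_) (integrable_const _) (.of_forall fun v => ?_)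
  · exact (hc.comp (Continuous.prodMk_right x)).aestronglyMeasurable
  · have hδ := h.δ_pos
    rw [norm_smul, mem_sphere_zero_iff_norm.1 v.2, mul_one, norm_mul,
      Real.norm_of_nonneg (by positivity)]
    gcongr
    exact hB _
  · exact hc.comp (Continuous.prodMk_left v)

theorem continuous_smoothed (h : Admissible K c r α δ) {f : K → ℝ} (hf : Continuous f) {B : ℝ}
    (hB : ∀ x, |f x| ≤ B) : Continuous (smoothed h f) := by
  have hc : Continuous fun p : shrunk K c r α × Metric.closedBall (0 : vectorSpan ℝ K) 1 =>
      f ⟨(p.1 : EuclideanSpace ℝ (Fin d)) +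
        δ • ((p.2 : vectorSpan ℝ K) : EuclideanSpace ℝ (Fin d)),
        h.add_mem p.1.2 p.2 (mem_closedBall_zero_iff.1 p.2.2)⟩ := hf.comp (by fun_prop)
  refine continuous_of_dominated (bound := fun _ => B) (fun x => ?_)
    (fun x => .of_forall fun v => hB _) (integrable_const _) (.of_forall fun v => ?_)
  · exact (hc.comp (Continuous.prodMk_right x)).aestronglyMeasurable
  · exact hc.comp (Continuous.prodMk_left v)

/-- Along the segment from `x` to `y` the increment of the smoothed function is the integral of the
inner products of `smoothedGrad` with `y - x`; subtracting the value at `x` leaves an integrand of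
size at most `C` times the length. -/
theorem abs_smoothed_sub_le (h : Admissible K c r α δ) {f : K → ℝ} (hf : Continuous f)
    {x y : shrunk K c r α} {C : ℝ}
    (hC : ∀ z : shrunk K c r α, (z : EuclideanSpace ℝ (Fin d)) ∈
      segment ℝ (x : EuclideanSpace ℝ (Fin d)) y → ‖smoothedGrad h f z - smoothedGrad h f x‖ ≤ C) :
    |smoothed h f y - smoothed h f x -
        ⟪(smoothedGrad h f x : EuclideanSpace ℝ (Fin d)), (y : EuclideanSpace ℝ (Fin d)) - x⟫_ℝ|
      ≤ C * ‖(y : EuclideanSpace ℝ (Fin d)) - x‖ := by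
  have := h.nontrivial_vectorSpan
  have := isProbabilityMeasure_unifSphere (vectorSpan ℝ K)
  set k : ℝ := (Module.finrank ℝ (vectorSpan ℝ K) : ℝ)
  have hδ := h.δ_pos
  let w : vectorSpan ℝ K := ⟨(y : EuclideanSpace ℝ (Fin d)) - x,
    vsub_mem_vectorSpan ℝ (h.shrunk_subset y.2) (h.shrunk_subset x.2)⟩
  have hseg : ∀ s ∈ Set.Icc (0 : ℝ) 1,
      (x : EuclideanSpace ℝ (Fin d)) + s • (w : EuclideanSpace ℝ (Fin d)) ∈
        segment ℝ (x : EuclideanSpace ℝ (Fin d)) y := by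
    intro s hs
    rw [segment_eq_image']
    exact ⟨s, hs, rfl⟩
  have hshr : ∀ s ∈ Set.Icc (0 : ℝ) 1,
      (x : EuclideanSpace ℝ (Fin d)) + s • (w : EuclideanSpace ℝ (Fin d)) ∈ shrunk K c r α :=
    fun s hs => h.convex_shrunk.segment_subset x.2 y.2 (hseg s hs)
  -- The displacements from `x` that occur in the averages along the segment. The set is compact,
  -- hence closed, so Tietze's theorem extends `f` from `x + D` to a continuous function on the
  -- whole linear space, where the identity for balls applies; `K` itself need not be closed.
  let D : Set (vectorSpan ℝ K) := (fun p : ℝ × vectorSpan ℝ K => p.1 • w + δ • p.2) ''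
    (Set.Icc (0 : ℝ) 1 ×ˢ Metric.closedBall 0 1)
  have hD : IsClosed D := ((isCompact_Icc.prod (isCompact_closedBall _ _)).image
    (by fun_prop)).isClosed
  have hDK : ∀ u ∈ D, (x : EuclideanSpace ℝ (Fin d)) + (u : EuclideanSpace ℝ (Fin d)) ∈ K := by
    rintro _ ⟨⟨s, v⟩, ⟨hs, hv⟩, rfl⟩
    have := h.add_mem (hshr s hs) v (mem_closedBall_zero_iff.1 hv)
    simpa [add_assoc] using this
  obtain ⟨F, hF⟩ := ContinuousMap.exists_restrict_eq hD
    ⟨fun u : D => f ⟨x + (u : vectorSpan ℝ K), hDK u u.2⟩, hf.comp (by fun_prop)⟩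
  have hFD : ∀ u (hu : u ∈ D), F u = f ⟨x + u, hDK u hu⟩ := fun u hu =>
    congrArg (fun G : C(D, ℝ) => G ⟨u, hu⟩) hF
  have hmem : ∀ s ∈ Set.Icc (0 : ℝ) 1, ∀ v : vectorSpan ℝ K, ‖v‖ ≤ 1 → s • w + δ • v ∈ D :=
    fun s hs v hv => ⟨(s, v), ⟨hs, mem_closedBall_zero_iff.2 hv⟩, rfl⟩
  have h1 : smoothed h f y = ∫ v, F (w + δ • (v : vectorSpan ℝ K)) ∂(unifBall (vectorSpan ℝ K)) := by
    refine integral_congr_ae (.of_forall fun v => ?_)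
    have hm := hmem 1 (by simp) v (mem_closedBall_zero_iff.1 v.2)
    rw [one_smul] at hm
    simp only
    rw [hFD _ hm]
    congr 2
    simp [w, ← add_assoc]
  have h0 : smoothed h f x = ∫ v, F (δ • (v : vectorSpan ℝ K)) ∂(unifBall (vectorSpan ℝ K)) := by
    refine integral_congr_ae (.of_forall fun v => ?_)
    have hm := hmem 0 (by simp) v (mem_closedBall_zero_iff.1 v.2)
    rw [zero_smul, zero_add] at hm
    simp only
    rw [hFD _ hm]
    rfl
  let g : ℝ → ℝ := fun s => k / δ *
    ∫ v, F (s • w + δ • (v : vectorSpan ℝ K)) * ⟪(v : vectorSpan ℝ K), w⟫_ℝ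
      ∂(unifSphere (vectorSpan ℝ K))
  have hgc : Continuous g := by
    have : Continuous fun s : ℝ => ∫ v : Dir K,
        F (s • w + δ • (v : vectorSpan ℝ K)) * ⟪(v : vectorSpan ℝ K), w⟫_ℝ
          ∂((volume : Measure (vectorSpan ℝ K)).toSphere) :=
      continuous_integral_toSphere (X := ℝ)
        (f := fun s (v : Dir K) => F (s • w + δ • (v : vectorSpan ℝ K)) *
          ⟪(v : vectorSpan ℝ K), w⟫_ℝ) (by fun_prop)
    simp only [g, integral_unifSphere]
    fun_prop
  have hg : ∀ s (hs : s ∈ Set.Icc (0 : ℝ) 1),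
      g s = ⟪smoothedGrad h f ⟨_, hshr s hs⟩, w⟫_ℝ := by
    intro s hs
    have hint : Integrable (fun v : Dir K => (k / δ * f (perturb h ⟨_, hshr s hs⟩ v)) •
        (v : vectorSpan ℝ K)) (unifSphere (vectorSpan ℝ K)) := by
      have hc : Continuous (fun v : Dir K => (k / δ * f (perturb h ⟨_, hshr s hs⟩ v)) •
        (v : vectorSpan ℝ K)) :=
        (continuous_const.mul (hf.comp ((continuous_perturb h).comp
          (Continuous.prodMk_right _)))).smul continuous_subtype_val
      rw [← integrableOn_univ]
      exact hc.continuousOn.integrableOn_compact isCompact_univ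
    simp only [g]
    rw [real_inner_comm, smoothedGrad, ← integral_inner hint, ← integral_const_mul]
    refine integral_congr_ae (.of_forall fun v => ?_)
    have hm := hmem s hs v (mem_sphere_zero_iff_norm.1 v.2).le
    simp only
    refine Eq.trans ?_ (real_inner_smul_right w (v : vectorSpan ℝ K) _).symm
    rw [hFD _ hm, real_inner_comm, mul_assoc]
    congr 3
    simp [perturb, add_assoc]
  have hw : ⟪(smoothedGrad h f x : EuclideanSpace ℝ (Fin d)),
      (y : EuclideanSpace ℝ (Fin d)) - x⟫_ℝ = ⟪smoothedGrad h f x, w⟫_ℝ := rfl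
  have key := integral_unifBall_translate_sub F.continuous w hδ
  rw [← h1, ← h0] at key
  have hsub : smoothed h f y - smoothed h f x - ⟪smoothedGrad h f x, w⟫_ℝ
      = ∫ s in (0 : ℝ)..1, (g s - ⟪smoothedGrad h f x, w⟫_ℝ) := by
    rw [intervalIntegral.integral_sub (hgc.intervalIntegrable _ _)
      (continuous_const.intervalIntegrable _ _), key]
    simp [g, k]
  rw [hw, hsub, ← Real.norm_eq_abs]
  have := intervalIntegral.norm_integral_le_of_norm_le_const (a := 0) (b := 1) (C := C * ‖w‖)
    (f := fun s => g s - ⟪smoothedGrad h f x, w⟫_ℝ) fun s hs => ?_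
  · simpa using this
  · rw [Set.uIoc_of_le zero_le_one] at hs
    have hs' : s ∈ Set.Icc (0 : ℝ) 1 := ⟨hs.1.le, hs.2⟩
    rw [hg s hs', ← inner_sub_left]
    exact (norm_inner_le_norm _ _).trans
      (mul_le_mul_of_nonneg_right (hC _ (hseg s hs')) (norm_nonneg _))

theorem isGradientAt_smoothed (h : Admissible K c r α δ) {f : K → ℝ} (hf : Continuous f) {B : ℝ}
    (hB : ∀ x, |f x| ≤ B) (x : shrunk K c r α) :
    IsGradientAt (smoothed h f) x (smoothedGrad h f x) := by
  refine ⟨h.vectorSpan_le (smoothedGrad h f x).2, ?_⟩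
  rw [isLittleO_iff]
  intro C hC
  obtain ⟨η, hη, hηC⟩ := Metric.continuous_iff.1 (continuous_smoothedGrad h hf hB) x C hC
  filter_upwards [Metric.ball_mem_nhds x hη] with y hy
  refine abs_smoothed_sub_le h hf fun z hz => ?_
  rw [← dist_eq_norm]
  refine (hηC z ?_).le
  -- A ball is convex, so the whole segment stays where the gradient differs from its value at `x`
  -- by less than `C`.
  have := (convex_ball (x : EuclideanSpace ℝ (Fin d)) η).segment_subset
    (Metric.mem_ball_self hη) hy hz
  exact this

end Gradient

/-! ### The law of the game -/

section GameLaw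

open scoped ENNReal

variable {T : ℕ} {K O : Type} [MeasurableSpace K] [MeasurableSpace O]

instance isMarkovKernel_observation (A : Agent T K O) (B : ObliviousAdversary T K O) (t : Fin T) :
    IsMarkovKernel (observation A B t) := by
  unfold observation
  infer_instance

theorem measurable_snoc (A : Agent T K O) (t : ℕ) (ht : t < T) :
    Measurable fun p : (A.Ω × (Fin t → K × O)) × O =>
      (p.1.1, Fin.snoc (α := fun _ => K × O) p.1.2 (A.act ⟨t, ht⟩ p.1.1 p.1.2, p.2)) := by
  have hact : Measurable fun p : (A.Ω × (Fin t → K × O)) × O => A.act ⟨t, ht⟩ p.1.1 p.1.2 :=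
    (A.measurable_act ⟨t, ht⟩).comp measurable_fst
  refine (measurable_fst.comp measurable_fst).prodMk (measurable_pi_lambda _ fun s => ?_)
  refine Fin.lastCases ?_ (fun s => ?_) s
  · simp only [Fin.snoc_last]
    exact hact.prodMk measurable_snd
  · simp only [Fin.snoc_castSucc]
    exact (measurable_pi_apply s).comp (measurable_snd.comp measurable_fst)

instance isProbabilityMeasure_gameLaw (A : Agent T K O) (B : ObliviousAdversary T K O) (t : ℕ)
    (ht : t ≤ T) : IsProbabilityMeasure (gameLaw A B t ht) := by
  induction t with
  | zero =>
    exact Measure.isProbabilityMeasure_map (measurable_id.prodMk measurable_const).aemeasurable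
  | succ t ih =>
    have := ih (Nat.le_of_succ_le ht)
    have hk : IsMarkovKernel (α := A.Ω × (Fin t → K × O)) (observation A B ⟨t, ht⟩) :=
      isMarkovKernel_observation A B ⟨t, ht⟩
    have : IsProbabilityMeasure (gameLaw A B t (Nat.le_of_succ_le ht) ⊗ₘ observation A B ⟨t, ht⟩) :=
      inferInstance
    exact Measure.isProbabilityMeasure_map (measurable_snoc A t ht).aemeasurable

theorem lintegral_gameLaw_zero (A : Agent T K O) (B : ObliviousAdversary T K O)
    {g : A.Ω × (Fin 0 → K × O) → ℝ≥0∞} (hg : Measurable g) :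
    ∫⁻ p, g p ∂(gameLaw A B 0 (Nat.zero_le T)) = ∫⁻ ω, g (ω, Fin.elim0) ∂A.P :=
  lintegral_map hg (measurable_id.prodMk measurable_const)

theorem lintegral_gameLaw_succ (A : Agent T K O) (B : ObliviousAdversary T K O) (t : ℕ)
    (ht : t + 1 ≤ T) {g : A.Ω × (Fin (t + 1) → K × O) → ℝ≥0∞} (hg : Measurable g) :
    ∫⁻ p, g p ∂(gameLaw A B (t + 1) ht) =
      ∫⁻ p, ∫⁻ o, g (p.1, Fin.snoc (α := fun _ => K × O) p.2 (A.act ⟨t, ht⟩ p.1 p.2, o))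
        ∂(B.oracle ⟨t, ht⟩ (A.act ⟨t, ht⟩ p.1 p.2)) ∂(gameLaw A B t (Nat.le_of_succ_le ht)) := by
  have hm := measurable_snoc A t ht
  have hk : IsMarkovKernel (α := A.Ω × (Fin t → K × O)) (observation A B ⟨t, ht⟩) :=
    isMarkovKernel_observation A B ⟨t, ht⟩
  rw [gameLaw, lintegral_map hg hm]
  exact Measure.lintegral_compProd (hg.comp hm)

end GameLaw

/-! ### Resampling one coordinate of a product measure -/

section Resample

open scoped ENNReal

variable {ι X : Type*} [Fintype ι] [DecidableEq ι] [MeasurableSpace X] (σ : Measure X)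
  [IsProbabilityMeasure σ]

/-- It suffices to check boxes: the overwritten coordinate contributes total mass one and the new
one contributes its own factor. -/
theorem measurePreserving_update (i : ι) :
    MeasurePreserving (fun p : X × (ι → X) => Function.update p.2 i p.1)
      (σ.prod (Measure.pi fun _ => σ)) (Measure.pi fun _ => σ) := by
  have hm : Measurable fun p : X × (ι → X) => Function.update p.2 i p.1 := by
    refine measurable_pi_lambda _ fun j => ?_
    by_cases hj : j = i
    · subst hj
      simpa using measurable_fst
    · simpa [hj] using (measurable_pi_apply (X := fun _ => X) j).fun_comp measurable_snd
  refine ⟨hm, (Measure.pi_eq fun s hs => ?_).symm⟩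
  rw [Measure.map_apply hm (MeasurableSet.univ_pi hs)]
  have : (fun p : X × (ι → X) => Function.update p.2 i p.1) ⁻¹' Set.univ.pi s
      = s i ×ˢ Set.univ.pi (Function.update s i Set.univ) := by
    ext p
    simp only [Set.mem_preimage, Set.mem_pi, Set.mem_univ, true_implies, Set.mem_prod]
    constructor
    · intro h
      refine ⟨by simpa using h i, fun j => ?_⟩
      by_cases hj : j = i
      · subst hj; simp
      · simpa [hj] using h j
    · rintro ⟨h1, h2⟩ j
      by_cases hj : j = i
      · subst hj; simpa using h1
      · simpa [hj] using h2 j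
  rw [this, Measure.prod_prod, Measure.pi_pi, ← Finset.mul_prod_erase _ _ (Finset.mem_univ i),
    ← Finset.mul_prod_erase Finset.univ (fun j => σ (s j)) (Finset.mem_univ i)]
  simp only [Function.update_self, measure_univ, one_mul]
  congr 1
  refine Finset.prod_congr rfl fun j hj => ?_
  rw [Function.update_of_ne (Finset.ne_of_mem_erase hj)]

/-- Coordinate `i` is redrawn independently, which does not change the law; the second argument of
`g` does not notice. -/
theorem lintegral_pi_eq_lintegral_lintegral {g : X → (ι → X) → ℝ≥0∞}
    (hg : Measurable g.uncurry) (i : ι) (hi : ∀ x v y, g x (Function.update v i y) = g x v) :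
    ∫⁻ v, g (v i) v ∂(Measure.pi fun _ => σ) = ∫⁻ x, ∫⁻ v, g x v ∂(Measure.pi fun _ => σ) ∂σ := by
  have hm : Measurable fun v : ι → X => g (v i) v :=
    hg.comp (f := fun v : ι → X => (v i, v)) ((measurable_pi_apply i).prodMk measurable_id)
  rw [← (measurePreserving_update σ i).lintegral_comp hm]
  have hm' : Measurable fun p : X × (ι → X) =>
      g (Function.update p.2 i p.1 i) (Function.update p.2 i p.1) :=
    hm.comp (measurePreserving_update σ i).measurable
  rw [lintegral_prod _ hm'.aemeasurable]
  simp only [Function.update_self, hi]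

end Resample

/-! ### The reduction of a zeroth-order adversary to a first-order adversary -/

section Reduction

open scoped ENNReal

variable {d T : ℕ} {K : Set (EuclideanSpace ℝ (Fin d))} {c : EuclideanSpace ℝ (Fin d)} {r α δ : ℝ}

/-- The gradient estimate `(k / δ) o v`. -/
def gradEstimate (δ : ℝ) (v : Dir K) (o : ℝ) : EuclideanSpace ℝ (Fin d) :=
  ((Module.finrank ℝ (vectorSpan ℝ K) : ℝ) / δ * o) •
    ((v : vectorSpan ℝ K) : EuclideanSpace ℝ (Fin d))

theorem continuous_gradEstimate (δ : ℝ) :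
    Continuous fun p : Dir K × ℝ => gradEstimate δ p.1 p.2 := by
  unfold gradEstimate
  fun_prop

theorem norm_gradEstimate (hδ : 0 < δ) (v : Dir K) (o : ℝ) :
    ‖gradEstimate δ v o‖ = (Module.finrank ℝ (vectorSpan ℝ K) : ℝ) / δ * ‖o‖ := by
  have hv : ‖((v : vectorSpan ℝ K) : EuclideanSpace ℝ (Fin d))‖ = 1 :=
    mem_sphere_zero_iff_norm.1 v.2
  rw [gradEstimate, norm_smul, hv, mul_one, norm_mul, Real.norm_of_nonneg (by positivity)]

/-- The joint law of a uniform direction `v` and of the answer of the value oracle at `x + δ v`. -/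
def sampleOracle (h : Admissible K c r α δ) (Q : Kernel K ℝ) : Kernel (shrunk K c r α) (Dir K × ℝ) :=
  Kernel.const _ (unifSphere (vectorSpan ℝ K)) ⊗ₖ
    Q.comap (fun p => perturb h p.1 p.2) (continuous_perturb h).measurable

/-- The law of `(k / δ) o v`, where `v` is a uniform direction and `o` is the answer of the value
oracle at `x + δ v`. -/
def gradOracle (h : Admissible K c r α δ) (Q : Kernel K ℝ) :
    Kernel (shrunk K c r α) (EuclideanSpace ℝ (Fin d)) :=
  (sampleOracle h Q).map fun p => gradEstimate δ p.1 p.2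

instance isMarkovKernel_gradOracle (h : Admissible K c r α δ) (Q : Kernel K ℝ) [IsMarkovKernel Q] :
    IsMarkovKernel (gradOracle h Q) := by
  have := h.nontrivial_vectorSpan
  have := isProbabilityMeasure_unifSphere (vectorSpan ℝ K)
  unfold gradOracle sampleOracle
  exact Kernel.IsMarkovKernel.map _ (continuous_gradEstimate δ).measurable

theorem lintegral_gradOracle (h : Admissible K c r α δ) (Q : Kernel K ℝ) [IsMarkovKernel Q]
    (x : shrunk K c r α) {g : EuclideanSpace ℝ (Fin d) → ℝ≥0∞} (hg : Measurable g) :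
    ∫⁻ e, g e ∂(gradOracle h Q x) =
      ∫⁻ v, ∫⁻ o, g (gradEstimate δ v o) ∂(Q (perturb h x v)) ∂(unifSphere (vectorSpan ℝ K)) := by
  have := h.nontrivial_vectorSpan
  have := isProbabilityMeasure_unifSphere (vectorSpan ℝ K)
  have hm : Measurable fun p : Dir K × ℝ => gradEstimate δ p.1 p.2 :=
    (continuous_gradEstimate δ).measurable
  rw [gradOracle, Kernel.map_apply _ hm, lintegral_map hg hm, sampleOracle]
  exact Kernel.lintegral_compProd _ _ _ (hg.comp hm)

theorem isBoundedOracle_gradOracle (h : Admissible K c r α δ) {Q : Kernel K ℝ} [IsMarkovKernel Q]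
    {B : ℝ} (hB : IsBoundedOracle Q B) :
    IsBoundedOracle (gradOracle h Q) ((Module.finrank ℝ (vectorSpan ℝ K) : ℝ) / δ * B) := by
  intro x
  have := h.nontrivial_vectorSpan
  have := isProbabilityMeasure_unifSphere (vectorSpan ℝ K)
  have hm : Measurable fun p : Dir K × ℝ => gradEstimate δ p.1 p.2 :=
    (continuous_gradEstimate δ).measurable
  have hs : MeasurableSet {p : Dir K × ℝ |
      ‖gradEstimate δ p.1 p.2‖ ≤ (Module.finrank ℝ (vectorSpan ℝ K) : ℝ) / δ * B} :=
    measurableSet_le hm.norm measurable_const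
  have hδ := h.δ_pos
  rw [gradOracle, Kernel.map_apply _ hm, ae_map_iff hm.aemeasurable
    (measurableSet_le measurable_norm measurable_const), sampleOracle,
    Kernel.ae_compProd_iff hs]
  refine .of_forall fun v => ?_
  filter_upwards [hB (perturb h x v)] with o ho
  rw [norm_gradEstimate hδ]
  gcongr

theorem integrable_gradOracle (h : Admissible K c r α δ) {Q : Kernel K ℝ} [IsMarkovKernel Q]
    {B : ℝ} (hB : IsBoundedOracle Q B) (x : shrunk K c r α) : Integrable id (gradOracle h Q x) :=
  Integrable.of_bound measurable_id.aestronglyMeasurable _ (isBoundedOracle_gradOracle h hB x)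

/-- Given the direction `v`, the estimate is linear in the answer, whose mean is `f (x + δ v)`;
averaging over `v` gives the sphere formula. -/
theorem integral_gradOracle (h : Admissible K c r α δ) {f : K → ℝ} (hf : Continuous f)
    {Q : Kernel K ℝ} [IsMarkovKernel Q] {B : ℝ} (hB : IsBoundedOracle Q B)
    (hQ : IsValueOracle f Q) (x : shrunk K c r α) :
    ∫ e, e ∂(gradOracle h Q x) = smoothedGrad h f x := by
  have := h.nontrivial_vectorSpan
  have := isProbabilityMeasure_unifSphere (vectorSpan ℝ K)
  have hm : Measurable fun p : Dir K × ℝ => gradEstimate δ p.1 p.2 :=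
    (continuous_gradEstimate δ).measurable
  have hi := integrable_gradOracle h hB x
  rw [gradOracle, Kernel.map_apply _ hm] at hi ⊢
  rw [integrable_map_measure measurable_id.aestronglyMeasurable hm.aemeasurable] at hi
  rw [integral_map (f := fun e => e) hm.aemeasurable measurable_id.aestronglyMeasurable]
  rw [sampleOracle] at hi ⊢
  refine (ProbabilityTheory.integral_compProd hi).trans ?_
  have hint : Integrable (fun v : Dir K =>
      ((Module.finrank ℝ (vectorSpan ℝ K) : ℝ) / δ * f (perturb h x v)) •
        (v : vectorSpan ℝ K)) (unifSphere (vectorSpan ℝ K)) := by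
    have hc : Continuous (fun v : Dir K =>
        ((Module.finrank ℝ (vectorSpan ℝ K) : ℝ) / δ * f (perturb h x v)) •
          (v : vectorSpan ℝ K)) :=
      (continuous_const.mul (hf.comp ((continuous_perturb h).comp
        (Continuous.prodMk_right _)))).smul continuous_subtype_val
    rw [← integrableOn_univ]
    exact hc.continuousOn.integrableOn_compact isCompact_univ
  have hcoe := (vectorSpan ℝ K).subtypeL.integral_comp_comm hint
  refine Eq.trans ?_ hcoe
  refine integral_congr_ae (.of_forall fun v => ?_)
  simp only [Kernel.comap_apply, gradEstimate, id, Function.comp]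
  rw [integral_smul_const, integral_const_mul, (hQ _).2]
  rfl

/-- The first-order adversary against which the base algorithm of `STB` plays. -/
def ObliviousAdversary.smooth (h : Admissible K c r α δ) (B : ObliviousAdversary T K ℝ) :
    ObliviousAdversary T (shrunk K c r α) (EuclideanSpace ℝ (Fin d)) where
  loss t := smoothed h (B.loss t)
  oracle t := gradOracle h (B.oracle t)

end Reduction

/-! ### The law of the game of `STB` -/

section Coupling

open scoped ENNReal

variable {d T : ℕ} {K : Set (EuclideanSpace ℝ (Fin d))} {c : EuclideanSpace ℝ (Fin d)} {r α δ : ℝ}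

theorem smooth_mem_advOne (h : Admissible K c r α δ) {F : Set (K → ℝ)}
    (hF : ∀ f ∈ F, Continuous f) {B₀ : ℝ} {B : ObliviousAdversary T K ℝ} (hB : B ∈ advZero T F B₀) :
    B.smooth h ∈
      advOne T (smoothedClass h F) ((Module.finrank ℝ (vectorSpan ℝ K) : ℝ) / δ * B₀) := by
  intro t
  obtain ⟨hl, hv, hb⟩ := hB t
  have hc := hF _ hl
  refine ⟨⟨_, hl, rfl⟩, ⟨integrable_gradOracle h hb, .inl fun x => ?_⟩,
    isBoundedOracle_gradOracle h hb⟩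
  -- The loss is the mean of answers bounded by `B₀`, so it inherits the bound.
  have hbd : ∀ x, |B.loss t x| ≤ B₀ := fun x => by
    rw [← (hv x).2, ← Real.norm_eq_abs]
    exact norm_integral_le_of_norm_le_const (hb x) |>.trans (by simp)
  have := isGradientAt_smoothed h hc hbd x
  rwa [← integral_gradOracle h hc hb hv x] at this

/-- The law of the game of `STB`, on the product of the randomness of the base algorithm, the
directions and the history. -/
def stbLaw (h : Admissible K c r α δ) (A : Agent T (shrunk K c r α) (EuclideanSpace ℝ (Fin d)))
    (B : ObliviousAdversary T K ℝ) (t : ℕ) (ht : t ≤ T) :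
    Measure ((A.Ω × (Fin T → Dir K)) × (Fin t → K × ℝ)) :=
  gameLaw (STB h A) B t ht

variable (h : Admissible K c r α δ) (A : Agent T (shrunk K c r α) (EuclideanSpace ℝ (Fin d)))
  (B : ObliviousAdversary T K ℝ)

instance isProbabilityMeasure_stbLaw (t : ℕ) (ht : t ≤ T) :
    IsProbabilityMeasure (stbLaw h A B t ht) :=
  isProbabilityMeasure_gameLaw (STB h A) B t ht

/-- The point that `STB` plays in round `t`. -/
def stbPlay (t : ℕ) (ht : t + 1 ≤ T) (p : (A.Ω × (Fin T → Dir K)) × (Fin t → K × ℝ)) : K :=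
  perturb h (A.act ⟨t, ht⟩ p.1.1
    (baseHistory δ A p.1.1 p.1.2 t (Nat.le_of_succ_le ht) fun s => (p.2 s).2)) (p.1.2 ⟨t, ht⟩)

theorem lintegral_stbLaw_zero {g : (A.Ω × (Fin T → Dir K)) × (Fin 0 → K × ℝ) → ℝ≥0∞}
    (hg : Measurable g) :
    ∫⁻ p, g p ∂(stbLaw h A B 0 (Nat.zero_le T)) = ∫⁻ ω, ∫⁻ v, g ((ω, v), Fin.elim0)
      ∂(Measure.pi fun _ => unifSphere (vectorSpan ℝ K)) ∂A.P := by
  have := h.nontrivial_vectorSpan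
  have := isProbabilityMeasure_unifSphere (vectorSpan ℝ K)
  have h1 : ∫⁻ p, g p ∂(stbLaw h A B 0 (Nat.zero_le T)) =
      ∫⁻ q, g (q, Fin.elim0) ∂(A.P.prod (Measure.pi fun _ => unifSphere (vectorSpan ℝ K))) :=
    lintegral_gameLaw_zero (STB h A) B hg
  have hm : Measurable fun q : A.Ω × (Fin T → Dir K) => g (q, Fin.elim0) :=
    hg.comp (measurable_id.prodMk measurable_const)
  rw [h1, lintegral_prod _ hm.aemeasurable]

theorem lintegral_stbLaw_succ (t : ℕ) (ht : t + 1 ≤ T)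
    {g : (A.Ω × (Fin T → Dir K)) × (Fin (t + 1) → K × ℝ) → ℝ≥0∞} (hg : Measurable g) :
    ∫⁻ p, g p ∂(stbLaw h A B (t + 1) ht) =
      ∫⁻ p, ∫⁻ o, g (p.1, Fin.snoc (α := fun _ => K × ℝ) p.2 (stbPlay h A t ht p, o))
        ∂(B.oracle ⟨t, ht⟩ (stbPlay h A t ht p)) ∂(stbLaw h A B t (Nat.le_of_succ_le ht)) :=
  lintegral_gameLaw_succ (STB h A) B t ht hg

/-- The history of the base algorithm, as a function of the outcome of the game of `STB`. -/
def baseOutcome (t : ℕ) (ht : t ≤ T) (p : (A.Ω × (Fin T → Dir K)) × (Fin t → K × ℝ)) :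
    Fin t → shrunk K c r α × EuclideanSpace ℝ (Fin d) :=
  baseHistory δ A p.1.1 p.1.2 t ht fun s => (p.2 s).2

variable (δ) in
theorem measurable_baseOutcome (t : ℕ) (ht : t ≤ T) :
    Measurable (baseOutcome (δ := δ) A t ht) :=
  (measurable_baseHistory δ A t ht).comp
    (f := fun p : (A.Ω × (Fin T → Dir K)) × (Fin t → K × ℝ) => (p.1, fun s : Fin t => (p.2 s).2))
    (measurable_fst.prodMk (measurable_pi_lambda _ fun s =>
      measurable_snd.comp ((measurable_pi_apply s).comp measurable_snd)))

variable (δ) in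
theorem baseOutcome_snoc (t : ℕ) (ht : t + 1 ≤ T)
    (p : (A.Ω × (Fin T → Dir K)) × (Fin t → K × ℝ)) (x : K) (o : ℝ) :
    baseOutcome (δ := δ) A (t + 1) ht (p.1, Fin.snoc (α := fun _ => K × ℝ) p.2 (x, o)) =
      Fin.snoc (α := fun _ => shrunk K c r α × EuclideanSpace ℝ (Fin d))
        (baseOutcome (δ := δ) A t (Nat.le_of_succ_le ht) p)
        (A.act ⟨t, ht⟩ p.1.1 (baseOutcome (δ := δ) A t (Nat.le_of_succ_le ht) p),
          gradEstimate δ (p.1.2 ⟨t, ht⟩) o) := by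
  simp only [baseOutcome, baseHistory, Fin.snoc_castSucc, Fin.snoc_last]
  rfl

/-- Directions of rounds not yet played are independent of everything the base algorithm has seen,
so they may be redrawn after the first `t` rounds. Letting `g` depend on these directions is what
makes the induction close: the next round consumes one of them. -/
theorem lintegral_stbLaw (t : ℕ) (ht : t ≤ T)
    {g : A.Ω → (Fin t → shrunk K c r α × EuclideanSpace ℝ (Fin d)) → (Fin T → Dir K) → ℝ≥0∞}
    (hg : Measurable fun q : A.Ω × (Fin t → shrunk K c r α × EuclideanSpace ℝ (Fin d)) ×
      (Fin T → Dir K) => g q.1 q.2.1 q.2.2)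
    (hgv : ∀ ω H v v', (∀ s : Fin T, t ≤ s → v s = v' s) → g ω H v = g ω H v') :
    ∫⁻ p, g p.1.1 (baseOutcome (δ := δ) A t ht p) p.1.2 ∂(stbLaw h A B t ht) =
      ∫⁻ p, ∫⁻ v, g p.1 p.2 v ∂(Measure.pi fun _ => unifSphere (vectorSpan ℝ K))
        ∂(gameLaw A (B.smooth h) t ht) := by
  have := h.nontrivial_vectorSpan
  have := isProbabilityMeasure_unifSphere (vectorSpan ℝ K)
  induction t with
  | zero =>
    have hm : Measurable fun p : (A.Ω × (Fin T → Dir K)) × (Fin 0 → K × ℝ) =>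
        g p.1.1 (baseOutcome (δ := δ) A 0 ht p) p.1.2 :=
      hg.comp (f := fun p : (A.Ω × (Fin T → Dir K)) × (Fin 0 → K × ℝ) =>
        (p.1.1, baseOutcome (δ := δ) A 0 ht p, p.1.2))
        ((measurable_fst.comp measurable_fst).prodMk
          ((measurable_baseOutcome δ A 0 ht).prodMk (measurable_snd.comp measurable_fst)))
    have hm' : Measurable fun p : A.Ω × (Fin 0 → shrunk K c r α × EuclideanSpace ℝ (Fin d)) =>
        ∫⁻ v, g p.1 p.2 v ∂(Measure.pi fun _ => unifSphere (vectorSpan ℝ K)) :=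
      Measurable.lintegral_prod_right' (f := fun q : (A.Ω × (Fin 0 → shrunk K c r α ×
        EuclideanSpace ℝ (Fin d))) × (Fin T → Dir K) => g q.1.1 q.1.2 q.2)
        (hg.comp (measurable_fst.fst.prodMk (measurable_fst.snd.prodMk measurable_snd)))
    rw [lintegral_stbLaw_zero h A B hm, lintegral_gameLaw_zero A (B.smooth h) hm']
    rfl
  | succ t ih =>
    have ht' := Nat.le_of_succ_le ht
    let act : A.Ω → (Fin t → shrunk K c r α × EuclideanSpace ℝ (Fin d)) → shrunk K c r α :=
      fun ω H => A.act ⟨t, ht⟩ ω H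
    have hact : Measurable fun q : A.Ω × (Fin t → shrunk K c r α × EuclideanSpace ℝ (Fin d)) =>
        act q.1 q.2 := A.measurable_act ⟨t, ht⟩
    -- The average of `g` over the answer in round `t`, with the direction `u` used in this round
    -- kept apart from the remaining ones.
    let G : A.Ω → (Fin t → shrunk K c r α × EuclideanSpace ℝ (Fin d)) → Dir K →
        (Fin T → Dir K) → ℝ≥0∞ := fun ω H u v =>
      ∫⁻ o, g ω (Fin.snoc (α := fun _ => shrunk K c r α × EuclideanSpace ℝ (Fin d)) H
        (act ω H, gradEstimate δ u o)) v ∂(B.oracle ⟨t, ht⟩ (perturb h (act ω H) u))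
    have hsnoc : Measurable fun q : ((A.Ω × (Fin t → shrunk K c r α × EuclideanSpace ℝ (Fin d))) ×
        EuclideanSpace ℝ (Fin d)) × (Fin T → Dir K) =>
        g q.1.1.1 (Fin.snoc (α := fun _ => shrunk K c r α × EuclideanSpace ℝ (Fin d)) q.1.1.2
          (act q.1.1.1 q.1.1.2, q.1.2)) q.2 := by
      have : Measurable fun q : ((A.Ω × (Fin t → shrunk K c r α × EuclideanSpace ℝ (Fin d))) ×
          EuclideanSpace ℝ (Fin d)) × (Fin T → Dir K) =>
          (q.1.1.1, Fin.snoc (α := fun _ => shrunk K c r α × EuclideanSpace ℝ (Fin d)) q.1.1.2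
            (act q.1.1.1 q.1.1.2, q.1.2)) := (measurable_snoc A t ht).comp measurable_fst
      exact hg.comp (this.fst.prodMk (this.snd.prodMk measurable_snd))
    have hG : Measurable fun q : (A.Ω × (Fin t → shrunk K c r α × EuclideanSpace ℝ (Fin d))) ×
        (Dir K × (Fin T → Dir K)) => G q.1.1 q.1.2 q.2.1 q.2.2 := by
      have hplay : Measurable fun q : (A.Ω × (Fin t → shrunk K c r α ×
          EuclideanSpace ℝ (Fin d))) × (Dir K × (Fin T → Dir K)) =>
          perturb h (act q.1.1 q.1.2) q.2.1 :=
        (continuous_perturb h).measurable.comp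
          ((hact.comp measurable_fst).prodMk measurable_snd.fst)
      refine Measurable.lintegral_kernel_prod_right' (κ := (B.oracle ⟨t, ht⟩).comap _ hplay)
        (f := fun q : ((A.Ω × (Fin t → shrunk K c r α × EuclideanSpace ℝ (Fin d))) ×
          (Dir K × (Fin T → Dir K))) × ℝ =>
            g q.1.1.1 (Fin.snoc (α := fun _ => shrunk K c r α × EuclideanSpace ℝ (Fin d)) q.1.1.2
              (act q.1.1.1 q.1.1.2, gradEstimate δ q.1.2.1 q.2)) q.1.2.2) ?_
      exact hsnoc.comp (((measurable_fst.fst).prodMk ((continuous_gradEstimate δ).measurable.comp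
        (measurable_fst.snd.fst.prodMk measurable_snd))).prodMk measurable_fst.snd.snd)
    -- After round `t`, `g` only looks at directions of index at least `t + 1`, so `G` ignores
    -- coordinate `t` of `v` and this coordinate can be redrawn as `u`.
    have hGt : ∀ ω H u v y, G ω H u (Function.update v ⟨t, ht⟩ y) = G ω H u v := by
      intro ω H u v y
      refine lintegral_congr fun o => hgv _ _ _ _ fun s hs => Function.update_of_ne ?_ _ _
      rintro rfl
      exact absurd hs (by simp)
    have hm : Measurable fun p : (A.Ω × (Fin T → Dir K)) × (Fin (t + 1) → K × ℝ) =>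
        g p.1.1 (baseOutcome (δ := δ) A (t + 1) ht p) p.1.2 :=
      hg.comp (f := fun p : (A.Ω × (Fin T → Dir K)) × (Fin (t + 1) → K × ℝ) =>
        (p.1.1, baseOutcome (δ := δ) A (t + 1) ht p, p.1.2))
        ((measurable_fst.comp measurable_fst).prodMk
          ((measurable_baseOutcome δ A (t + 1) ht).prodMk (measurable_snd.comp measurable_fst)))
    have hm' : Measurable fun p : A.Ω × (Fin (t + 1) → shrunk K c r α ×
        EuclideanSpace ℝ (Fin d)) =>
        ∫⁻ v, g p.1 p.2 v ∂(Measure.pi fun _ => unifSphere (vectorSpan ℝ K)) :=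
      Measurable.lintegral_prod_right' (f := fun q : (A.Ω × (Fin (t + 1) → shrunk K c r α ×
        EuclideanSpace ℝ (Fin d))) × (Fin T → Dir K) => g q.1.1 q.1.2 q.2)
        (hg.comp (measurable_fst.fst.prodMk (measurable_fst.snd.prodMk measurable_snd)))
    have hleft : ∫⁻ p, g p.1.1 (baseOutcome (δ := δ) A (t + 1) ht p) p.1.2
        ∂(stbLaw h A B (t + 1) ht) = ∫⁻ p, G p.1.1 (baseOutcome (δ := δ) A t ht' p)
          (p.1.2 ⟨t, ht⟩) p.1.2 ∂(stbLaw h A B t ht') := by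
      rw [lintegral_stbLaw_succ h A B t ht hm]
      simp only [baseOutcome_snoc]
      rfl
    rw [hleft, ih ht' (g := fun ω H v => G ω H (v ⟨t, ht⟩) v), lintegral_gameLaw_succ A _ t ht hm']
    · refine lintegral_congr fun p => ?_
      have hGp : Measurable (G p.1 p.2).uncurry :=
        hG.comp (measurable_const.prodMk measurable_id)
      rw [lintegral_pi_eq_lintegral_lintegral (unifSphere (vectorSpan ℝ K)) hGp ⟨t, ht⟩
        (hGt p.1 p.2)]
      have hinner : Measurable fun e : EuclideanSpace ℝ (Fin d) =>
          ∫⁻ v, g p.1 (Fin.snoc (α := fun _ => shrunk K c r α × EuclideanSpace ℝ (Fin d)) p.2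
            (act p.1 p.2, e)) v ∂(Measure.pi fun _ => unifSphere (vectorSpan ℝ K)) :=
        Measurable.lintegral_prod_right' (f := fun q : EuclideanSpace ℝ (Fin d) ×
          (Fin T → Dir K) => g p.1 (Fin.snoc (α := fun _ => shrunk K c r α ×
            EuclideanSpace ℝ (Fin d)) p.2 (act p.1 p.2, q.1)) q.2)
          (hsnoc.comp ((measurable_const.prodMk measurable_fst).prodMk measurable_snd))
      -- A fresh `u` followed by the answer at the perturbed point is exactly the recipe of the
      -- gradient oracle; only the order of the integrals over the answer and over `v` has to be
      -- exchanged.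
      refine Eq.trans ?_ (lintegral_gradOracle h (B.oracle ⟨t, ht⟩) (act p.1 p.2) hinner).symm
      refine lintegral_congr fun u => ?_
      refine lintegral_lintegral_swap (Measurable.aemeasurable ?_)
      exact hsnoc.comp ((measurable_const.prodMk ((continuous_gradEstimate δ).measurable.comp
        (measurable_const.prodMk measurable_snd))).prodMk measurable_fst)
    · exact hG.comp (f := fun q : A.Ω × (Fin t → shrunk K c r α × EuclideanSpace ℝ (Fin d)) ×
        (Fin T → Dir K) => ((q.1, q.2.1), (q.2.2 ⟨t, ht⟩, q.2.2)))
        ((measurable_fst.prodMk measurable_snd.fst).prodMk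
          (((measurable_pi_apply _).comp measurable_snd.snd).prodMk measurable_snd.snd))
    · intro ω H v v' hvv
      refine (congrArg (fun u => G ω H u v) (hvv ⟨t, ht⟩ le_rfl)).trans ?_
      exact lintegral_congr fun o => hgv _ _ _ _ fun s hs => hvv s (Nat.le_of_succ_le hs)

/-- The base algorithm of `STB` plays the game against the smoothed adversary. -/
theorem map_stbLaw :
    (stbLaw h A B T le_rfl).map (fun p => (p.1.1, baseOutcome (δ := δ) A T le_rfl p)) =
      gameLaw A (B.smooth h) T le_rfl := by
  have := h.nontrivial_vectorSpan
  have := isProbabilityMeasure_unifSphere (vectorSpan ℝ K)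
  refine Measure.ext_of_lintegral _ fun g hg => ?_
  rw [lintegral_map hg (measurable_fst.fst.prodMk (measurable_baseOutcome δ A T le_rfl))]
  rw [lintegral_stbLaw h A B T le_rfl (g := fun ω H _ => g (ω, H))
    (hg.comp (measurable_fst.prodMk measurable_snd.fst)) (fun _ _ _ _ _ => rfl)]
  simp

/-- The history records the points played, whereas `baseHistory` recomputes the base actions from
the answers alone. This reconciles the two, so that both losses can be compared on one space. -/
theorem ae_stbLaw_play (t : ℕ) (ht : t ≤ T) : ∀ᵐ p ∂(stbLaw h A B t ht), ∀ s : Fin t,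
    (p.2 s).1 = perturb h (baseOutcome (δ := δ) A t ht p s).1 (p.1.2 (Fin.castLE ht s)) := by
  induction t with
  | zero => exact .of_forall fun p s => s.elim0
  | succ t ih =>
    have hms : MeasurableSet {p : (A.Ω × (Fin T → Dir K)) × (Fin (t + 1) → K × ℝ) |
        ∀ s : Fin (t + 1), (p.2 s).1 =
          perturb h (baseOutcome (δ := δ) A (t + 1) ht p s).1 (p.1.2 (Fin.castLE ht s))} := by
      rw [Set.ofPred_forall]
      refine MeasurableSet.iInter fun s => ?_
      have h1 : Measurable fun p : (A.Ω × (Fin T → Dir K)) × (Fin (t + 1) → K × ℝ) =>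
          ((p.2 s).1 : EuclideanSpace ℝ (Fin d)) :=
        measurable_subtype_coe.comp ((measurable_pi_apply s).comp measurable_snd).fst
      have h2 : Measurable fun p : (A.Ω × (Fin T → Dir K)) × (Fin (t + 1) → K × ℝ) =>
          (baseOutcome (δ := δ) A (t + 1) ht p s).1 :=
        ((measurable_pi_apply s).comp (measurable_baseOutcome δ A (t + 1) ht)).fst
      have h3 : Measurable fun p : (A.Ω × (Fin T → Dir K)) × (Fin (t + 1) → K × ℝ) =>
          p.1.2 (Fin.castLE ht s) := (measurable_pi_apply _).comp measurable_fst.snd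
      have h4 : Measurable fun p : (A.Ω × (Fin T → Dir K)) × (Fin (t + 1) → K × ℝ) =>
          (perturb h (baseOutcome (δ := δ) A (t + 1) ht p s).1 (p.1.2 (Fin.castLE ht s)) :
            EuclideanSpace ℝ (Fin d)) :=
        measurable_subtype_coe.comp ((continuous_perturb h).measurable.comp (h2.prodMk h3))
      simp only [Subtype.ext_iff]
      exact measurableSet_eq_fun h1 h4
    -- The recursion for the law is stated for integrals, so the exceptional set is measured through
    -- its indicator.
    rw [ae_iff, ← Set.compl_ofPred, ← lintegral_indicator_one hms.compl,
      lintegral_stbLaw_succ h A B t ht (measurable_one.indicator hms.compl)]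
    refine (lintegral_congr_ae ?_).trans lintegral_zero
    filter_upwards [ih (Nat.le_of_succ_le ht)] with p hp
    refine (lintegral_congr fun o => ?_).trans lintegral_zero
    rw [Set.indicator_of_notMem]
    refine Set.notMem_compl_iff.2 fun s => ?_
    rw [baseOutcome_snoc]
    refine Fin.lastCases ?_ (fun s => ?_) s
    · simp only [Fin.snoc_last]
      rfl
    · simp only [Fin.snoc_castSucc]
      exact hp s

end Coupling

/-! ### The regret of `STB` -/

section Regret

variable {d T : ℕ} {K : Set (EuclideanSpace ℝ (Fin d))} {c : EuclideanSpace ℝ (Fin d)} {r α δ : ℝ}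

/-- The inclusion of the shrunk domain. -/
def Admissible.incl (h : Admissible K c r α δ) (x : shrunk K c r α) : K :=
  ⟨x, h.shrunk_subset x.2⟩

theorem abs_smoothed_le (h : Admissible K c r α δ) {f : K → ℝ} {B : ℝ} (hB : ∀ x, |f x| ≤ B)
    (x : shrunk K c r α) : |smoothed h f x| ≤ B := by
  rw [← Real.norm_eq_abs]
  exact (norm_integral_le_of_norm_le_const (.of_forall fun v => hB _)).trans (by simp)

theorem abs_smoothed_sub_le_of_forall (h : Admissible K c r α δ) {f : K → ℝ} (hf : Continuous f)
    {B : ℝ} (hB : ∀ x, |f x| ≤ B) {ε : ℝ} (x : shrunk K c r α)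
    (hε : ∀ (v : vectorSpan ℝ K) (hv : ‖v‖ ≤ 1),
      |f ⟨(x : EuclideanSpace ℝ (Fin d)) + δ • (v : EuclideanSpace ℝ (Fin d)),
        h.add_mem x.2 v hv⟩ - f (h.incl x)| ≤ ε) :
    |smoothed h f x - f (h.incl x)| ≤ ε := by
  have hc : Continuous fun v : Metric.closedBall (0 : vectorSpan ℝ K) 1 =>
      f ⟨(x : EuclideanSpace ℝ (Fin d)) + δ • ((v : vectorSpan ℝ K) : EuclideanSpace ℝ (Fin d)),
        h.add_mem x.2 v (mem_closedBall_zero_iff.1 v.2)⟩ := hf.comp (by fun_prop)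
  have hi := Integrable.of_bound (μ := unifBall (vectorSpan ℝ K)) hc.aestronglyMeasurable B
    (.of_forall fun v => hB _)
  have : smoothed h f x - f (h.incl x) = ∫ v : Metric.closedBall (0 : vectorSpan ℝ K) 1,
      (f ⟨(x : EuclideanSpace ℝ (Fin d)) + δ • ((v : vectorSpan ℝ K) : EuclideanSpace ℝ (Fin d)),
        h.add_mem x.2 v (mem_closedBall_zero_iff.1 v.2)⟩ - f (h.incl x))
          ∂(unifBall (vectorSpan ℝ K)) := by
    rw [integral_sub hi (integrable_const _)]
    simp [smoothed]
  rw [this, ← Real.norm_eq_abs]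
  exact (norm_integral_le_of_norm_le_const
    (.of_forall fun v : Metric.closedBall (0 : vectorSpan ℝ K) 1 =>
      hε v (mem_closedBall_zero_iff.1 v.2))).trans (by simp)

theorem realizedRegret_STB (h : Admissible K c r α δ)
    (A : Agent T (shrunk K c r α) (EuclideanSpace ℝ (Fin d))) (B : ObliviousAdversary T K ℝ)
    (U : Set (Fin T → K)) (a b : Fin T) :
    realizedRegret (STB h A) B U a b =
      ∫ p, (∑ t ∈ Finset.Icc a b, B.loss t (p.2 t).1
        - sInf ((fun u : Fin T → K => ∑ t ∈ Finset.Icc a b, B.loss t (u t)) '' U))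
        ∂(stbLaw h A B T le_rfl) := rfl

/-- The smoothed loss is within ε of the loss at the centre. A played point therefore costs at most
2ε more than the smoothed loss (`hplay`), and a shrunk comparator at most `ε + η` more than the
original (`hcomp`). -/
theorem realizedRegret_STB_le (h : Admissible K c r α δ)
    (A : Agent T (shrunk K c r α) (EuclideanSpace ℝ (Fin d))) (B : ObliviousAdversary T K ℝ)
    {U : Set (Fin T → K)} (hU : U.Nonempty) (a b : Fin T) {B₀ ε η : ℝ}
    (hcont : ∀ t, Continuous (B.loss t)) (hbd : ∀ t x, |B.loss t x| ≤ B₀) (hε : 0 ≤ ε) (hη : 0 ≤ η)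
    (hpert : ∀ t (x : shrunk K c r α) (v : vectorSpan ℝ K) (hv : ‖v‖ ≤ 1),
      |B.loss t ⟨(x : EuclideanSpace ℝ (Fin d)) + δ • (v : EuclideanSpace ℝ (Fin d)),
        h.add_mem x.2 v hv⟩ - B.loss t (h.incl x)| ≤ ε)
    (hshrink : ∀ t (y : K), B.loss t (h.incl (shrinkMap K c r α y)) - B.loss t y ≤ η) :
    realizedRegret (STB h A) B U a b ≤
      realizedRegret A (B.smooth h) (shrunkComparators c r α U) a b + (3 * ε + η) * T := by
  have hsm : ∀ t x, |smoothed h (B.loss t) x - B.loss t (h.incl x)| ≤ ε := fun t x =>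
    abs_smoothed_sub_le_of_forall h (hcont t) (hbd t) x (hpert t x)
  have hplay : ∀ t x v, B.loss t (perturb h x v) ≤ smoothed h (B.loss t) x + 2 * ε := by
    intro t x v
    have h1 := (abs_le.1 (hpert t x v (mem_sphere_zero_iff_norm.1 v.2).le)).2
    have h2 := (abs_le.1 (hsm t x)).1
    unfold perturb
    linarith
  have hcomp : ∀ t y, smoothed h (B.loss t) (shrinkMap K c r α y) ≤ B.loss t y + (ε + η) := by
    intro t y
    have h1 := (abs_le.1 (hsm t (shrinkMap K c r α y))).2
    have h2 := hshrink t y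
    linarith
  let N : ℝ := (Finset.Icc a b).card
  have hN : ((Finset.Icc a b).card : ℝ) ≤ T := by
    have := Finset.card_le_univ (Finset.Icc a b)
    rw [Fintype.card_fin] at this
    exact_mod_cast this
  let m := sInf ((fun u : Fin T → K => ∑ t ∈ Finset.Icc a b, B.loss t (u t)) '' U)
  let m' := sInf ((fun u : Fin T → shrunk K c r α =>
    ∑ t ∈ Finset.Icc a b, smoothed h (B.loss t) (u t)) '' shrunkComparators c r α U)
  have hm : m' ≤ m + N * (ε + η) := by
    rw [← sub_le_iff_le_add]
    refine le_csInf (hU.image _) ?_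
    rintro _ ⟨u, hu, rfl⟩
    rw [sub_le_iff_le_add]
    refine (csInf_le ?_ (Set.mem_image_of_mem _ (Set.mem_image_of_mem _ hu))).trans ?_
    -- A real infimum is bounded by its members only if the set is bounded below, which the bound on
    -- the smoothed losses provides.
    · refine ⟨∑ t ∈ Finset.Icc a b, -B₀, ?_⟩
      rintro _ ⟨w, -, rfl⟩
      exact Finset.sum_le_sum fun t _ => (abs_le.1 (abs_smoothed_le h (hbd t) _)).1
    · refine (Finset.sum_le_sum fun t _ => hcomp t (u t)).trans ?_
      rw [Finset.sum_add_distrib, Finset.sum_const, nsmul_eq_mul]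
  have hright : realizedRegret A (B.smooth h) (shrunkComparators c r α U) a b =
      ∫ p, (∑ t ∈ Finset.Icc a b, smoothed h (B.loss t) (baseOutcome (δ := δ) A T le_rfl p t).1 - m')
        ∂(stbLaw h A B T le_rfl) := by
    rw [realizedRegret, ← map_stbLaw h A B, integral_map]
    · rfl
    · exact (measurable_fst.fst.prodMk (measurable_baseOutcome δ A T le_rfl)).aemeasurable
    · refine Measurable.aestronglyMeasurable (Measurable.sub_const (Finset.measurable_sum _
        fun t _ => ?_) _)
      exact (continuous_smoothed h (hcont t) (hbd t)).measurable.comp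
        ((measurable_pi_apply t).comp measurable_snd).fst
  have hi1 : Integrable (fun p : (A.Ω × (Fin T → Dir K)) × (Fin T → K × ℝ) =>
      ∑ t ∈ Finset.Icc a b, B.loss t (p.2 t).1 - m) (stbLaw h A B T le_rfl) := by
    refine (integrable_finsetSum _ fun t _ => ?_).sub (integrable_const _)
    exact Integrable.of_bound ((hcont t).measurable.comp
      ((measurable_pi_apply t).comp measurable_snd).fst).aestronglyMeasurable B₀
      (.of_forall fun p => hbd t _)
  have hi2 : Integrable (fun p : (A.Ω × (Fin T → Dir K)) × (Fin T → K × ℝ) =>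
      ∑ t ∈ Finset.Icc a b, smoothed h (B.loss t) (baseOutcome (δ := δ) A T le_rfl p t).1 - m')
      (stbLaw h A B T le_rfl) := by
    refine (integrable_finsetSum _ fun t _ => ?_).sub (integrable_const _)
    exact Integrable.of_bound ((continuous_smoothed h (hcont t) (hbd t)).measurable.comp
      ((measurable_pi_apply t).comp (measurable_baseOutcome δ A T le_rfl)).fst).aestronglyMeasurable
      B₀ (.of_forall fun p => abs_smoothed_le h (hbd t) _)
  have hmono : realizedRegret (STB h A) B U a b ≤
      ∫ p, ((∑ t ∈ Finset.Icc a b,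
        smoothed h (B.loss t) (baseOutcome (δ := δ) A T le_rfl p t).1 - m') + N * (3 * ε + η))
        ∂(stbLaw h A B T le_rfl) := by
    rw [realizedRegret_STB]
    refine integral_mono_ae hi1 (hi2.add (integrable_const _)) ?_
    filter_upwards [ae_stbLaw_play h A B T le_rfl] with p hp
    have h1 : ∑ t ∈ Finset.Icc a b, B.loss t (p.2 t).1 ≤ ∑ t ∈ Finset.Icc a b,
        (smoothed h (B.loss t) (baseOutcome (δ := δ) A T le_rfl p t).1 + 2 * ε) :=
      Finset.sum_le_sum fun t _ => by
        rw [hp t]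
        exact hplay _ _ _
    rw [Finset.sum_add_distrib, Finset.sum_const, nsmul_eq_mul] at h1
    change _ - m ≤ _
    have h2 : ((Finset.Icc a b).card : ℝ) = N := rfl
    rw [h2] at h1
    linarith
  rw [integral_add hi2 (integrable_const _), ← hright] at hmono
  simp only [integral_const, probReal_univ, one_smul] at hmono
  have : N * (3 * ε + η) ≤ (3 * ε + η) * T := by
    rw [mul_comm]
    gcongr
  linarith

/-- The constants are requested only for nonempty `F`: otherwise no adversary exists, since `a`
witnesses a round, and the supremum is `⊥`. Nonemptiness is what later makes `M₀` nonnegative. -/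
theorem regret_STB_le (h : Admissible K c r α δ) {F : Set (K → ℝ)} (hF : ∀ f ∈ F, Continuous f)
    {U : Set (Fin T → K)} (hU : U.Nonempty)
    (A : Agent T (shrunk K c r α) (EuclideanSpace ℝ (Fin d))) (a b : Fin T) (B₀ : ℝ) {C : ℝ}
    (H : F.Nonempty → ∃ ε η : ℝ, 0 ≤ ε ∧ 0 ≤ η ∧ 3 * ε + η ≤ C ∧
      (∀ f ∈ F, ∀ (x : shrunk K c r α) (v : vectorSpan ℝ K) (hv : ‖v‖ ≤ 1),
        |f ⟨(x : EuclideanSpace ℝ (Fin d)) + δ • (v : EuclideanSpace ℝ (Fin d)),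
          h.add_mem x.2 v hv⟩ - f (h.incl x)| ≤ ε) ∧
      ∀ f ∈ F, ∀ y : K, f (h.incl (shrinkMap K c r α y)) - f y ≤ η) :
    regret (STB h A) (advZero T F B₀) U a b ≤
      regret A (advOne T (smoothedClass h F) (Module.finrank ℝ (vectorSpan ℝ K) / δ * B₀))
          (shrunkComparators c r α U) a b + ((C * T : ℝ) : EReal) := by
  refine iSup₂_le fun B hB => ?_
  obtain ⟨ε, η, hε, hη, hC, hpert, hshrink⟩ := H ⟨_, (hB a).1⟩
  have hbd : ∀ t x, |B.loss t x| ≤ B₀ := fun t x => by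
    rw [← ((hB t).2.1 x).2, ← Real.norm_eq_abs]
    exact (norm_integral_le_of_norm_le_const ((hB t).2.2 x)).trans (by simp)
  have h1 := realizedRegret_STB_le h A B hU a b (fun t => hF _ (hB t).1) hbd hε hη
    (fun t => hpert _ (hB t).1) (fun t => hshrink _ (hB t).1)
  have h2 : (3 * ε + η) * T ≤ C * T := by gcongr
  calc ((realizedRegret (STB h A) B U a b : ℝ) : EReal)
      ≤ ((realizedRegret A (B.smooth h) (shrunkComparators c r α U) a b + C * T : ℝ) : EReal) := by
        exact_mod_cast h1.trans (by gcongr)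
    _ = ((realizedRegret A (B.smooth h) (shrunkComparators c r α U) a b : ℝ) : EReal)
          + ((C * T : ℝ) : EReal) := EReal.coe_add _ _
    _ ≤ _ := by
        gcongr
        exact le_iSup₂ (f := fun B' _ =>
          ((realizedRegret A B' (shrunkComparators c r α U) a b : ℝ) : EReal)) (B.smooth h)
          (smooth_mem_advOne h hF hB)

/-- A convex function with oscillation at most `M` varies by at most `(δ / α) M` over the
perturbations of a point of the shrunk domain. -/
theorem abs_sub_le_of_isConvexFun (h : Admissible K c r α δ) {f : K → ℝ} (hf : IsConvexFun f)
    {M : ℝ} (hM : ∀ x y, f x - f y ≤ M) (x : shrunk K c r α) (v : vectorSpan ℝ K) (hv : ‖v‖ ≤ 1) :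
    |f ⟨(x : EuclideanSpace ℝ (Fin d)) + δ • (v : EuclideanSpace ℝ (Fin d)),
      h.add_mem x.2 v hv⟩ - f (h.incl x)| ≤ δ / α * M := by
  have hα := h.smoothing_pos
  have hδ := h.δ_pos
  have hs0 : 0 ≤ δ / α := by positivity
  have hs1 : δ / α ≤ 1 := (div_le_one hα).2 h.δ_le
  -- The room around a shrunk point is α, not just δ: `x + δ w` divides the segment from `x` to `x +
  -- α w` in the ratio `δ / α`, so convexity damps the oscillation by this factor.
  have h' : Admissible K c r α α :=
    ⟨h.convex, h.nontrivial, h.mem_relint, h.r_pos, h.ball_subset, hα, le_rfl, h.α_lt⟩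
  let far : ∀ w : vectorSpan ℝ K, ‖w‖ ≤ 1 → K := fun w hw =>
    ⟨(x : EuclideanSpace ℝ (Fin d)) + α • (w : EuclideanSpace ℝ (Fin d)), h'.add_mem x.2 w hw⟩
  have hcoef : δ / α * α = δ := by field_simp
  have key : ∀ (w : vectorSpan ℝ K) (hw : ‖w‖ ≤ 1),
      f ⟨(x : EuclideanSpace ℝ (Fin d)) + δ • (w : EuclideanSpace ℝ (Fin d)),
        h.add_mem x.2 w hw⟩ - f (h.incl x) ≤ δ / α * M := by
    intro w hw
    have h1 := hf (far w hw) (h.incl x) ⟨_, h.add_mem x.2 w hw⟩ (δ / α) hs0 hs1 (by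
      simp only [far, Admissible.incl, smul_add, smul_smul, hcoef]
      module)
    have h2 := mul_le_mul_of_nonneg_left (hM (far w hw) (h.incl x)) hs0
    linarith
  have hv' : ‖-v‖ ≤ 1 := by rwa [norm_neg]
  have h1 := key v hv
  have h2 := key (-v) hv'
  -- The lower bound comes from the upper bound at `-v`, as `x` is the midpoint of `x + δ v` and `x
  -- - δ v`.
  have h3 := hf ⟨_, h.add_mem x.2 v hv⟩ ⟨_, h.add_mem x.2 (-v) hv'⟩ (h.incl x) (1 / 2)
    (by norm_num) (by norm_num) (by
      simp only [Admissible.incl, Submodule.coe_neg]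
      module)
  rw [abs_le]
  constructor <;> linarith

/-- The shrunk point is a convex combination of `c`, with weight `α / r`, and `y`. -/
theorem apply_shrinkMap_sub_le (h : Admissible K c r α δ) {f : K → ℝ} (hf : IsConvexFun f)
    {M : ℝ} (hM : ∀ x y, f x - f y ≤ M) (y : K) :
    f (h.incl (shrinkMap K c r α y)) - f y ≤ α / r * M := by
  have hα := h.smoothing_pos
  have hr := h.r_pos
  have hs0 : 0 ≤ α / r := by positivity
  let c' : K := ⟨c, intrinsicInterior_subset h.mem_relint⟩
  have h1 := hf c' y (h.incl (shrinkMap K c r α y)) (α / r) hs0 h.ratio_lt_one.le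
    (add_comm _ _)
  have h2 := mul_le_mul_of_nonneg_left (hM c' y) hs0
  linarith

end Regret

end OnlineOpt

end

/-! ### The three regret bounds -/

theorem mainTheorem5 {d T : ℕ} {K : Set (EuclideanSpace ℝ (Fin d))}
    {c : EuclideanSpace ℝ (Fin d)} {r α δ : ℝ} (h : Admissible K c r α δ)
    (F : Set (K → ℝ)) (hF : ∀ f ∈ F, Continuous f)
    (U : Set (Fin T → K)) (hU : IsCompact U) (hU' : U.Nonempty)
    (A : Agent T (shrunk K c r α) (EuclideanSpace ℝ (Fin d)))
    (a b : Fin T) (hab : a ≤ b) (B₀ : ℝ) :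
    -- convex losses with values in `[-M₀, M₀]`
    (∀ M₀ : ℝ, (∀ f ∈ F, IsConvexFun f ∧ ∀ x, |f x| ≤ M₀) →
      regret (STB h A) (advZero T F B₀) U a b ≤
        regret A (advOne T (smoothedClass h F) (Module.finrank ℝ (vectorSpan ℝ K) / δ * B₀))
            (shrunkComparators c r α U) a b
          + (((6 * δ / α + 2 * α / r) * M₀ * T : ℝ) : EReal)) ∧
    -- convex losses with values in `[0, M₀]`
    (∀ M₀ : ℝ, (∀ f ∈ F, IsConvexFun f ∧ ∀ x, 0 ≤ f x ∧ f x ≤ M₀) →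
      regret (STB h A) (advZero T F B₀) U a b ≤
        regret A (advOne T (smoothedClass h F) (Module.finrank ℝ (vectorSpan ℝ K) / δ * B₀))
            (shrunkComparators c r α U) a b
          + (((6 * δ / α + α / r) * M₀ * T : ℝ) : EReal)) ∧
    -- Lipschitz losses, not necessarily convex
    (∀ (M₁ : NNReal) (D : ℝ), (∀ f ∈ F, LipschitzWith M₁ f) →
      (∃ p, K ⊆ Metric.closedBall p D) →
      regret (STB h A) (advZero T F B₀) U a b ≤
        regret A (advOne T (smoothedClass h F) (Module.finrank ℝ (vectorSpan ℝ K) / δ * B₀))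
            (shrunkComparators c r α U) a b
          + (((3 + 2 * D * α / (r * δ)) * δ * M₁ * T : ℝ) : EReal)) := by
  have hα := h.smoothing_pos
  have hr := h.r_pos
  have hδ := h.δ_pos
  have hcK : c ∈ K := intrinsicInterior_subset h.mem_relint
  refine ⟨fun M₀ hM => ?_, fun M₀ hM => ?_, fun M₁ D hM ⟨p, hp⟩ => ?_⟩
  · refine regret_STB_le h hF hU' A a b B₀ fun ⟨f₀, hf₀⟩ => ?_
    have hM₀ : 0 ≤ M₀ := (abs_nonneg _).trans ((hM f₀ hf₀).2 ⟨c, hcK⟩)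
    have hosc : ∀ f ∈ F, ∀ x y, f x - f y ≤ 2 * M₀ := fun f hf x y => by
      have h1 := (abs_le.1 ((hM f hf).2 x)).2
      have h2 := (abs_le.1 ((hM f hf).2 y)).1
      linarith
    -- The oscillation is at most `2 * M₀`, whence 6 = 3 · 2 and the factor 2 in front of `α / r`.
    refine ⟨δ / α * (2 * M₀), α / r * (2 * M₀), by positivity, by positivity, le_of_eq (by ring),
      fun f hf => abs_sub_le_of_isConvexFun h (hM f hf).1 (hosc f hf),
      fun f hf => apply_shrinkMap_sub_le h (hM f hf).1 (hosc f hf)⟩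
  · refine regret_STB_le h hF hU' A a b B₀ fun ⟨f₀, hf₀⟩ => ?_
    have hM₀ : 0 ≤ M₀ := ((hM f₀ hf₀).2 ⟨c, hcK⟩).1.trans ((hM f₀ hf₀).2 ⟨c, hcK⟩).2
    have hosc : ∀ f ∈ F, ∀ x y, f x - f y ≤ M₀ := fun f hf x y => by
      have h1 := ((hM f hf).2 x).2
      have h2 := ((hM f hf).2 y).1
      linarith
    refine ⟨δ / α * M₀, α / r * M₀, by positivity, by positivity, ?_,
      fun f hf => abs_sub_le_of_isConvexFun h (hM f hf).1 (hosc f hf),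
      fun f hf => apply_shrinkMap_sub_le h (hM f hf).1 (hosc f hf)⟩
    have : 0 ≤ δ / α * M₀ := by positivity
    -- With oscillation `M₀` the argument yields 3δ/α; the stated 6δ/α is weaker.
    calc 3 * (δ / α * M₀) + α / r * M₀ ≤ 6 * (δ / α * M₀) + α / r * M₀ := by linarith
      _ = _ := by ring
  · refine regret_STB_le h hF hU' A a b B₀ fun _ => ?_
    have hD : 0 ≤ D := dist_nonneg.trans (hp hcK)
    -- Shrinking moves `y` by `(α / r) (c - y)`, and two points of a ball of radius `D` are at most
    -- `2 * D` apart.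
    refine ⟨M₁ * δ, M₁ * (α / r * (2 * D)), by positivity, by positivity,
      le_of_eq (by field_simp), fun f hf x v hv => ?_, fun f hf y => ?_⟩
    · rw [← Real.dist_eq]
      refine ((hM f hf).dist_le_mul _ _).trans ?_
      gcongr
      rw [Subtype.dist_eq, dist_eq_norm]
      simp only [Admissible.incl, add_sub_cancel_left, norm_smul, Real.norm_of_nonneg hδ.le]
      exact mul_le_of_le_one_right hδ.le hv
    · refine (le_abs_self _).trans ?_
      rw [← Real.dist_eq]
      refine ((hM f hf).dist_le_mul _ _).trans ?_
      gcongr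
      have h1 : dist c (y : EuclideanSpace ℝ (Fin d)) ≤ 2 * D := by
        have := dist_triangle_right c (y : EuclideanSpace ℝ (Fin d)) p
        have h2 : dist c p ≤ D := hp hcK
        have h3 : dist (y : EuclideanSpace ℝ (Fin d)) p ≤ D := hp y.2
        linarith
      have h2 : (h.incl (shrinkMap K c r α y) : EuclideanSpace ℝ (Fin d)) - y
          = (α / r) • (c - y) := by
        simp only [Admissible.incl, shrinkMap]
        module
      rw [Subtype.dist_eq, dist_eq_norm, h2, norm_smul, Real.norm_of_nonneg (by positivity),
        ← dist_eq_norm]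
      gcongr
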